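/- **Classical back-and-forth relations.** Regard groups as structures in the language with symbols for product, inverse and identity. For groups $G,H$, tuples $\vec a\in G^n$, $\vec b\in H^n$ and an ordinal $\alpha$, define $(G,\vec a)\equiv^{\mathrm{bf}}_\alpha(H,\vec b)$ by recursion: for $\alpha=0$ it means that $\vec a$ and $\vec b$ satisfy the same quantifier-free formulas; for $\alpha>0$ it means that for every $\beta<\alpha$ and every finite tuple $\vec c$ from $G$ there is a tuple $\vec d$ from $H$ of the same length with $(G,\vec a\vec c)\equiv^{\mathrm{bf}}_\beta(H,\vec b\vec d)$, and for every $\beta<\alpha$ and every finite tuple $\vec d$ from $H$ there is a tuple $\vec c$ from $G$ of the same length with $(G,\vec a\vec c)\equiv^{\mathrm{bf}}_\beta(H,\vec b\vec d)$. Write $G\equiv^{\mathrm{bf}}_\alpha H$ if this holds for the empty tuples. **Weak moduli and basic formulas.** A weak modulus is a function $\Omega:[0,\infty)^{\mathbb N}\to[0,\infty]$ that is non-decreasing, subadditive, vanishing at zero, lower semicontinuous for the product topology, and continuous in each argument; $\Omega{\upharpoonright}_n(\delta_1,\dots,\delta_n)=\Omega(\delta_1,\dots,\delta_n,0,0,\dots)$.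 In a (many-sorted) metric language every function symbol $F$ has a modulus $\Delta_F$, every predicate symbol $P$ (including the metric of each sort) has a modulus $\Delta_P$ and a compact interval $I_P$ of values. Terms have moduli $\Delta_{x_i}(\vec\delta)=\delta_i$ and $\Delta_{F(\vec\tau)}=\Delta_F\circ(\Delta_{\tau_j})_j$; atomic formulas $P(\vec\tau)$ have modulus $\Delta_P\circ(\Delta_{\tau_j})_j$ and interval $I_P$. A basic formula is $\psi=f(\varphi_1,\dots,\varphi_k)$ with $\varphi_i$ atomic and $f:\prod_i I_{\varphi_i}\to\mathbb R$ continuous; its modulus is $\Delta_\psi=\Delta_f\circ(\Delta_{\varphi_i})_i$, where $\Delta_f(\vec\delta)=\sup\{|f(\vec x)-f(\vec y)|:|x_i-y_i|\le\delta_i\}$. A basic formula $\psi(x_1,\dots,x_n)$ is a basic $\Omega$-formula if $\Delta_\psi\le\Omega{\upharpoonright}_n$. **Continuous back-and-forth relations.** For metric structures $M,N$ in the same language and $n$-tuples $\vec a$ from $M$, $\vec b$ from $N$ whose corresponding entries have the same sort, put $r_0(\vec a,\vec b)=\sup_\varphi|\varphi^M(\vec a)-\varphi^N(\vec b)|\in[0,\infty]$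 over all basic $\Omega$-formulas $\varphi(x_1,\dots,x_n)$ in variables of these sorts, and for $\alpha>0$ $$r_\alpha(\vec a,\vec b)=\max\Big(\sup_{\beta<\alpha}\sup_{\vec c\in M}\inf_{\vec d\in N}r_\beta(\vec a\vec c,\vec b\vec d),\ \sup_{\beta<\alpha}\sup_{\vec d\in N}\inf_{\vec c\in M}r_\beta(\vec a\vec c,\vec b\vec d)\Big),$$ where $\vec c,\vec d$ range over finite tuples of arbitrary length, the response having the same length and sorts as the tuple it answers. Write $M\equiv^{\Omega}_\alpha N$ if $r_\alpha(\varnothing,\varnothing)=0$. **Group von Neumann algebras.** For a group $G$ let $u_g$ be the unitary on $\ell^2(G)$ with $u_g\delta_h=\delta_{gh}$, and let $L(G)$ be the closure of the linear span $\mathbb C[G]$ of $\{u_g:g\in G\}$ in the strong operator topology on $B(\ell^2(G))$, with trace $\mathrm{tr}(x)=\langle x\delta_e,\delta_e\rangle$ and $\|x\|_2=\sqrt{\mathrm{tr}(x^*x)}$. It is regarded as a many-sorted metric structure: for each integer $n\ge1$ there is a sort for the operator norm ball of radius $n$, with the metric $\|x-y\|_2$ with values in $[0,2n]$ and modulus $\delta_1+\delta_2$;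 the function symbols are the constants $0,1$ in the ball of radius $1$, the inclusions of smaller balls into larger ones and the adjoint on each ball (modulus $\delta$), addition from the balls of radii $m,n$ to that of radius $m+n$ (modulus $\delta_1+\delta_2$), multiplication from the balls of radii $m,n$ to that of radius $mn$ (modulus $n\delta_1+m\delta_2$), and multiplication by each $c\in\mathbb C$ from the ball of radius $n$ to that of radius $\max(1,\lceil|c|\rceil)\,n$ (modulus $|c|\delta$); the predicates are the real and imaginary parts of $\mathrm{tr}$ on the ball of radius $n$, with values in $[-n,n]$ and modulus $\delta$. **Theorem.** For any ordinal $\alpha$, if $G$ and $H$ are groups such that $G\equiv^{\mathrm{bf}}_{1+\alpha}H$, then for every weak modulus $\Omega$ we have $L(G)\equiv^{\Omega}_\alpha L(H)$. -/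

import Mathlib

open scoped NNReal ENNReal

noncomputable section

/-! ## Classical symmetric back-and-forth relations -/

/-- The standard symmetric back-and-forth relation `(M, a) ≡_α (N, b)` between first-order
`L`-structures with distinguished `n`-tuples: at `α = 0` the quantifier-free types agree; at
`α > 0`, for every `β < α` every finite tuple on one side is matched by a tuple of the same length
on the other side so that the concatenated tuples are related at level `β`. -/
def BackForth (L : FirstOrder.Language) (M N : Type*) [L.Structure M] [L.Structure N]
    (α : Ordinal) (n : ℕ) (a : Fin n → M) (b : Fin n → N) : Prop :=
  (α = 0 → ∀ φ : L.Formula (Fin n), φ.IsQF → (φ.Realize a ↔ φ.Realize b)) ∧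
  (∀ β : Ordinal, β < α →
    (∀ (m : ℕ) (c : Fin m → M), ∃ d : Fin m → N,
      BackForth L M N β (n + m) (Fin.append a c) (Fin.append b d)) ∧
    (∀ (m : ℕ) (d : Fin m → N), ∃ c : Fin m → M,
      BackForth L M N β (n + m) (Fin.append a c) (Fin.append b d)))
termination_by α

/-- Function symbols of the language of groups. -/
inductive GroupFunc : ℕ → Type
  | mul : GroupFunc 2
  | inv : GroupFunc 1
  | one : GroupFunc 0

/-- The first-order language of groups, with symbols for product, inverse and identity. -/
def groupLanguage : FirstOrder.Language where
  Functions := GroupFunc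
  Relations := fun _ => Empty

/-- Every group is a structure in the language of groups. -/
instance groupStructure (G : Type*) [Group G] : groupLanguage.Structure G where
  funMap := fun {_} f x => match f, x with
    | .mul, x => x 0 * x 1
    | .inv, x => (x 0)⁻¹
    | .one, _ => 1
  RelMap := fun {_} r _ => r.elim

/-- `G ≡_α H` for groups. -/
def GroupBackForth (G H : Type*) [Group G] [Group H] (α : Ordinal) : Prop :=
  BackForth groupLanguage G H α 0 Fin.elim0 Fin.elim0

/-! ## Moduli -/

/-- A modulus of arity `n`. -/
structure IsModulus {n : ℕ} (Δ : (Fin n → ℝ≥0) → ℝ≥0) : Prop where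
  mono : Monotone Δ
  subadd : ∀ x y, Δ (x + y) ≤ Δ x + Δ y
  zero : Δ 0 = 0
  cont : Continuous Δ

/-- A weak modulus `Ω : [0,∞)^ℕ → [0,∞]`. -/
structure WeakModulus where
  toFun : (ℕ → ℝ≥0) → ℝ≥0∞
  mono : Monotone toFun
  subadd : ∀ x y, toFun (x + y) ≤ toFun x + toFun y
  zero : toFun 0 = 0
  lsc : LowerSemicontinuous toFun
  cont_arg : ∀ (i : ℕ) (δ : ℕ → ℝ≥0),
    Continuous fun t : ℝ≥0 => toFun (Function.update δ i t)

/-- The truncation `Ω↾n (δ₁, …, δₙ) = Ω (δ₁, …, δₙ, 0, 0, …)`. -/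
def WeakModulus.trunc (Ω : WeakModulus) (n : ℕ) (δ : Fin n → ℝ≥0) : ℝ≥0∞ :=
  Ω.toFun fun i => if h : i < n then δ ⟨i, h⟩ else 0

/-! ## Many-sorted metric languages, structures and basic formulas -/

/-- A many-sorted metric language. Each sort carries a bound on its diameter, each function symbol
a modulus, each predicate symbol a modulus and a compact interval of values. The metric of each
sort is a logical symbol, see `MetricLanguage.Atomic`. -/
structure MetricLanguage where
  Sorts : Type
  diam : Sorts → ℝ≥0
  /-- function symbols with `k` arguments of the sorts `dom` and a value of the sort `cod` -/
  Func : (k : ℕ) → (dom : Fin k → Sorts) → (cod : Sorts) → Type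
  funcMod : ∀ {k dom cod}, Func k dom cod → (Fin k → ℝ≥0) → ℝ≥0
  funcMod_isModulus : ∀ {k dom cod} (f : Func k dom cod), IsModulus (funcMod f)
  /-- predicate symbols with `k` arguments of the sorts `dom` -/
  Pred : (k : ℕ) → (dom : Fin k → Sorts) → Type
  predMod : ∀ {k dom}, Pred k dom → (Fin k → ℝ≥0) → ℝ≥0
  predMod_isModulus : ∀ {k dom} (P : Pred k dom), IsModulus (predMod P)
  predLo : ∀ {k dom}, Pred k dom → ℝ
  predHi : ∀ {k dom}, Pred k dom → ℝ

/-- A metric structure in the language `L`. -/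
structure MetricStructure (L : MetricLanguage) where
  Carrier : L.Sorts → Type*
  metric : ∀ s, MetricSpace (Carrier s)
  complete : ∀ s, CompleteSpace (Carrier s)
  dist_le_diam : ∀ s (x y : Carrier s), dist x y ≤ L.diam s
  fn : ∀ {k dom cod}, L.Func k dom cod → (∀ j : Fin k, Carrier (dom j)) → Carrier cod
  fn_obeys : ∀ {k dom cod} (f : L.Func k dom cod) (x y : ∀ j : Fin k, Carrier (dom j)),
    nndist (fn f x) (fn f y) ≤ L.funcMod f fun j => nndist (x j) (y j)
  pr : ∀ {k dom}, L.Pred k dom → (∀ j : Fin k, Carrier (dom j)) → ℝ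
  pr_mem : ∀ {k dom} (P : L.Pred k dom) (x : ∀ j : Fin k, Carrier (dom j)),
    pr P x ∈ Set.Icc (L.predLo P) (L.predHi P)
  pr_obeys : ∀ {k dom} (P : L.Pred k dom) (x y : ∀ j : Fin k, Carrier (dom j)),
    nndist (pr P x) (pr P y) ≤ L.predMod P fun j => nndist (x j) (y j)

attribute [instance] MetricStructure.metric MetricStructure.complete

namespace MetricLanguage

variable {L : MetricLanguage} {n : ℕ}

/-- Terms in the variables `x₁, …, xₙ`, where `xᵢ` has the sort `s i`. -/
inductive Term (L : MetricLanguage) {n : ℕ} (s : Fin n → L.Sorts) : L.Sorts → Type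
  | var (i : Fin n) : Term L s (s i)
  | app {k : ℕ} {dom : Fin k → L.Sorts} {cod : L.Sorts} (f : L.Func k dom cod)
      (τ : ∀ j, Term L s (dom j)) : Term L s cod

/-- The value of a term. -/
def Term.eval {s : Fin n → L.Sorts} (M : MetricStructure L) (a : ∀ i, M.Carrier (s i)) :
    ∀ {t : L.Sorts}, Term L s t → M.Carrier t
  | _, .var i => a i
  | _, .app f τ => M.fn f fun j => (τ j).eval M a

/-- The modulus attached to a term. -/
def Term.modulus {s : Fin n → L.Sorts} :
    ∀ {t : L.Sorts}, Term L s t → (Fin n → ℝ≥0) → ℝ≥0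
  | _, .var i, δ => δ i
  | _, .app f τ, δ => L.funcMod f fun j => (τ j).modulus δ

/-- Atomic formulas `P(τ₁, …, τₖ)` and `d(τ₁, τ₂)`. -/
inductive Atomic (L : MetricLanguage) {n : ℕ} (s : Fin n → L.Sorts) : Type
  | pred {k : ℕ} {dom : Fin k → L.Sorts} (P : L.Pred k dom) (τ : ∀ j, Term L s (dom j)) :
      Atomic L s
  | dist {t : L.Sorts} (τ₁ τ₂ : Term L s t) : Atomic L s

/-- The value of an atomic formula. -/
def Atomic.eval {s : Fin n → L.Sorts} (M : MetricStructure L) (a : ∀ i, M.Carrier (s i)) :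
    Atomic L s → ℝ
  | .pred P τ => M.pr P fun j => (τ j).eval M a
  | .dist τ₁ τ₂ => Dist.dist (τ₁.eval M a) (τ₂.eval M a)

/-- The modulus attached to an atomic formula; the metric has the modulus `δ₁ + δ₂`. -/
def Atomic.modulus {s : Fin n → L.Sorts} : Atomic L s → (Fin n → ℝ≥0) → ℝ≥0
  | .pred P τ, δ => L.predMod P fun j => (τ j).modulus δ
  | .dist τ₁ τ₂, δ => τ₁.modulus δ + τ₂.modulus δ

/-- The compact interval attached to an atomic formula. -/
def Atomic.bound {s : Fin n → L.Sorts} : Atomic L s → Set ℝ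
  | .pred P _ => Set.Icc (L.predLo P) (L.predHi P)
  | .dist (t := t) _ _ => Set.Icc 0 (L.diam t)

/-- The least modulus of a real function on a set `K` of `k`-tuples. -/
def leastModulus {k : ℕ} (K : Set (Fin k → ℝ)) (f : (Fin k → ℝ) → ℝ) (δ : Fin k → ℝ≥0) : ℝ≥0∞ :=
  ⨆ (x ∈ K) (y ∈ K) (_ : ∀ i, |x i - y i| ≤ δ i), edist (f x) (f y)

/-- Basic formulas `f(φ₁, …, φₖ)`: the `φᵢ` are atomic and `f` is a real function that is
continuous on the product of the intervals attached to the `φᵢ` (its values elsewhere are never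
used). -/
structure BasicFormula (L : MetricLanguage) {n : ℕ} (s : Fin n → L.Sorts) where
  arity : ℕ
  atom : Fin arity → Atomic L s
  conn : (Fin arity → ℝ) → ℝ
  conn_cont : ContinuousOn conn (Set.univ.pi fun i => (atom i).bound)

/-- The value of a basic formula. -/
def BasicFormula.eval {s : Fin n → L.Sorts} (M : MetricStructure L) (a : ∀ i, M.Carrier (s i))
    (φ : BasicFormula L s) : ℝ :=
  φ.conn fun i => (φ.atom i).eval M a

/-- The modulus attached to a basic formula. -/
def BasicFormula.modulus {s : Fin n → L.Sorts} (φ : BasicFormula L s) (δ : Fin n → ℝ≥0) : ℝ≥0∞ :=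
  leastModulus (Set.univ.pi fun i => (φ.atom i).bound) φ.conn fun i => (φ.atom i).modulus δ

/-- A basic formula in `x₁, …, xₙ` is an `Ω`-formula if its modulus is at most `Ω↾n`. -/
def BasicFormula.Respects {s : Fin n → L.Sorts} (φ : BasicFormula L s) (Ω : WeakModulus) : Prop :=
  ∀ δ, φ.modulus δ ≤ Ω.trunc n δ

end MetricLanguage

/-! ## The continuous back-and-forth pseudo-distances -/

/-- A pair of `n`-tuples `a` from `M` and `b` from `N` whose corresponding entries have the same
sort: the `i`-th entry is `⟨sᵢ, aᵢ, bᵢ⟩`. -/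
abbrev TuplePair {L : MetricLanguage} (M N : MetricStructure L) (n : ℕ) :=
  Fin n → (Σ s : L.Sorts, M.Carrier s × N.Carrier s)

/-- The pair of concatenated tuples `(a c, b d)`, where `c` and `d` are tuples of sorts `t`. -/
def TuplePair.concat {L : MetricLanguage} {M N : MetricStructure L} {n m : ℕ}
    (p : TuplePair M N n) (t : Fin m → L.Sorts) (c : ∀ j, M.Carrier (t j))
    (d : ∀ j, N.Carrier (t j)) : TuplePair M N (n + m) :=
  Fin.append p fun j => ⟨t j, c j, d j⟩

/-- The rank `0` pseudo-distance: the supremum of `|φ^M(a) - φ^N(b)|` over the basic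
`Ω`-formulas `φ`. -/
def bfDistZero {L : MetricLanguage} (Ω : WeakModulus) (M N : MetricStructure L) {n : ℕ}
    (p : TuplePair M N n) : ℝ≥0∞ :=
  ⨆ (φ : MetricLanguage.BasicFormula L fun i => (p i).1) (_ : φ.Respects Ω),
    edist (φ.eval M fun i => (p i).2.1) (φ.eval N fun i => (p i).2.2)

/-- The back-and-forth pseudo-distance `r_α^{M,N}(a, b)` with respect to `Ω`. -/
def bfDist {L : MetricLanguage} (Ω : WeakModulus) (M N : MetricStructure L) (α : Ordinal) (n : ℕ)
    (p : TuplePair M N n) : ℝ≥0∞ :=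
  open Classical in
  if α = 0 then bfDistZero Ω M N p
  else
    (⨆ (β : Set.Iio α) (m : ℕ) (t : Fin m → L.Sorts) (c : ∀ j, M.Carrier (t j)),
      ⨅ d : ∀ j, N.Carrier (t j), bfDist Ω M N β.1 (n + m) (p.concat t c d)) ⊔
    (⨆ (β : Set.Iio α) (m : ℕ) (t : Fin m → L.Sorts) (d : ∀ j, N.Carrier (t j)),
      ⨅ c : ∀ j, M.Carrier (t j), bfDist Ω M N β.1 (n + m) (p.concat t c d))
termination_by α
decreasing_by all_goals exact β.2

/-- `M ≡^Ω_α N`. -/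
def MetricBackForth {L : MetricLanguage} (Ω : WeakModulus) (α : Ordinal)
    (M N : MetricStructure L) : Prop :=
  bfDist Ω M N α 0 Fin.elim0 = 0

/-! ## The language of tracial von Neumann algebras -/

/-- Function symbols of the language of tracial von Neumann algebras. The sort `n` stands for the
operator norm ball of radius `n`. -/
inductive VNFunc : (k : ℕ) → (Fin k → ℕ+) → ℕ+ → Type
  | zero : VNFunc 0 ![] 1
  | one : VNFunc 0 ![] 1
  | incl (m n : ℕ+) (h : m ≤ n) : VNFunc 1 ![m] n
  | add (m n : ℕ+) : VNFunc 2 ![m, n] (m + n)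
  | mul (m n : ℕ+) : VNFunc 2 ![m, n] (m * n)
  | smul (c : ℂ) (n : ℕ+) : VNFunc 1 ![n] (Nat.toPNat' ⌈‖c‖⌉₊ * n)
  | star (n : ℕ+) : VNFunc 1 ![n] n

/-- Predicate symbols: the real and imaginary parts of the trace on each sort. -/
inductive VNPred : (k : ℕ) → (Fin k → ℕ+) → Type
  | reTr (n : ℕ+) : VNPred 1 ![n]
  | imTr (n : ℕ+) : VNPred 1 ![n]

/-- The moduli of the function symbols. -/
def VNFunc.mod : ∀ {k dom cod}, VNFunc k dom cod → (Fin k → ℝ≥0) → ℝ≥0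
  | _, _, _, .zero, _ => 0
  | _, _, _, .one, _ => 0
  | _, _, _, .incl _ _ _, δ => δ 0
  | _, _, _, .add _ _, δ => δ 0 + δ 1
  | _, _, _, .mul m n, δ => (n : ℝ≥0) * δ 0 + (m : ℝ≥0) * δ 1
  | _, _, _, .smul c _, δ => ‖c‖₊ * δ 0
  | _, _, _, .star _, δ => δ 0

theorem VNFunc.mod_isModulus {k dom cod} (f : VNFunc k dom cod) : IsModulus f.mod := by
  cases f <;> refine ⟨fun x y h => ?_, fun x y => ?_, ?_, ?_⟩ <;> unfold VNFunc.mod <;>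
    first
    | simp; done
    | exact le_refl _
    | exact h 0
    | exact add_le_add (h 0) (h 1)
    | exact mul_le_mul_right (h 0) _
    | exact add_le_add (mul_le_mul_right (h 0) _) (mul_le_mul_right (h 1) _)
    | (apply le_of_eq; simp only [Pi.add_apply]; ring)
    | fun_prop

/-- The moduli of the predicate symbols. -/
def VNPred.mod : ∀ {k dom}, VNPred k dom → (Fin k → ℝ≥0) → ℝ≥0
  | _, _, .reTr _, δ => δ 0
  | _, _, .imTr _, δ => δ 0

theorem VNPred.mod_isModulus {k dom} (P : VNPred k dom) : IsModulus P.mod := by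
  cases P <;> exact ⟨fun x y h => h 0, fun x y => le_refl _, rfl, continuous_apply 0⟩

/-- The predicates on the sort `n` take values in `[-n, n]`. -/
def VNPred.radius : ∀ {k dom}, VNPred k dom → ℝ
  | _, _, .reTr n => (n : ℝ)
  | _, _, .imTr n => (n : ℝ)

/-- The language of tracial von Neumann algebras. -/
def vnLanguage : MetricLanguage where
  Sorts := ℕ+
  diam n := 2 * (n : ℝ≥0)
  Func := VNFunc
  funcMod := VNFunc.mod
  funcMod_isModulus := VNFunc.mod_isModulus
  Pred := VNPred
  predMod := VNPred.mod
  predMod_isModulus := VNPred.mod_isModulus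
  predLo P := -P.radius
  predHi P := P.radius


/-! ## Group von Neumann algebras -/

/-- The Hilbert space `ℓ²(G)`. -/
abbrev EllTwo (G : Type*) := lp (fun _ : G => ℂ) 2

theorem memlp_comp_equiv {G : Type*} (e : G ≃ G) (ξ : EllTwo G) :
    Memℓp (fun h => ξ (e h)) 2 := by
  have h2 : 0 < (2 : ℝ≥0∞).toReal := by norm_num
  have := (memℓp_gen_iff h2).1 (lp.memℓp ξ)
  exact (memℓp_gen_iff h2).2 (e.summable_iff (f := fun i => ‖ξ i‖ ^ (2 : ℝ≥0∞).toReal) |>.2 this)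

/-- The isometry `(U ξ)(h) = ξ (e⁻¹ h)` of `ℓ²(G)`, which maps `δ_h` to `δ_{e h}`. -/
def permIsometry {G : Type*} (e : Equiv.Perm G) : EllTwo G →ₗᵢ[ℂ] EllTwo G where
  toFun := fun ξ => ⟨fun h => ξ (e.symm h), memlp_comp_equiv e.symm ξ⟩
  map_add' := fun ξ η => rfl
  map_smul' := fun c ξ => rfl
  norm_map' := fun ξ => by
    have h2 : 0 < (2 : ℝ≥0∞).toReal := by norm_num
    rw [lp.norm_eq_tsum_rpow h2, lp.norm_eq_tsum_rpow h2]
    congr 1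
    exact e.symm.tsum_eq (fun i => ‖ξ i‖ ^ (2 : ℝ≥0∞).toReal)

/-- The same isometry as a bounded operator. -/
def permOp {G : Type*} (e : Equiv.Perm G) : EllTwo G →L[ℂ] EllTwo G :=
  (permIsometry e).toContinuousLinearMap

theorem permOp_apply {G : Type*} (e : Equiv.Perm G) (ξ : EllTwo G) (h : G) :
    permOp e ξ h = ξ (e.symm h) := rfl

theorem norm_permOp {G : Type*} (e : Equiv.Perm G) (ξ : EllTwo G) : ‖permOp e ξ‖ = ‖ξ‖ :=
  (permIsometry e).norm_map ξ

open Classical in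
/-- The basis vector `δ_g` of `ℓ²(G)`. -/
def basisVec {G : Type*} (g : G) : EllTwo G := lp.single 2 g 1

open Classical in
theorem basisVec_apply {G : Type*} (g h : G) :
    (basisVec g : EllTwo G) h = if h = g then 1 else 0 := by
  simp [basisVec, Pi.single_apply]

theorem permOp_basisVec {G : Type*} (e : Equiv.Perm G) (g : G) :
    permOp e (basisVec g) = basisVec (e g) := by
  classical
  ext h
  rw [permOp_apply, basisVec_apply, basisVec_apply]
  congr 1
  exact propext e.symm_apply_eq

theorem norm_basisVec {G : Type*} (g : G) : ‖(basisVec g : EllTwo G)‖ = 1 := by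
  classical
  rw [basisVec, lp.norm_single (by norm_num)]; simp

theorem inner_basisVec {G : Type*} (g : G) (ξ : EllTwo G) : inner ℂ (basisVec g) ξ = ξ g := by
  classical
  rw [basisVec, lp.inner_single_left]; simp

theorem span_basisVec {G : Type*} :
    (Submodule.span ℂ (Set.range (basisVec : G → EllTwo G))).topologicalClosure = ⊤ := by
  rw [← Submodule.orthogonal_orthogonal_eq_closure, Submodule.orthogonal_eq_top_iff, eq_bot_iff]
  intro ξ hξ
  rw [Submodule.mem_bot]
  ext g
  rw [← inner_basisVec g ξ]
  exact hξ _ (Submodule.subset_span ⟨g, rfl⟩)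

section GroupVN

open Filter Topology ContinuousLinearMap

variable (G : Type*) [Group G]

/-- The left regular representation: `(u_g ξ)(h) = ξ (g⁻¹ h)`, so that `u_g δ_h = δ_{g h}`. -/
def leftRegular : G →* (EllTwo G →L[ℂ] EllTwo G) where
  toFun g := permOp (Equiv.mulLeft g)
  map_one' := by
    ext ξ h
    simp [permOp_apply]
    rfl
  map_mul' g g' := by
    ext ξ h
    simp only [permOp_apply, Equiv.mulLeft_symm_apply, mul_inv_rev, mul_assoc,
      mul_apply_eq_comp]

/-- The extension of the left regular representation to the group algebra `ℂ[G]`. -/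
def groupAlgebraRep : MonoidAlgebra ℂ G →ₐ[ℂ] (EllTwo G →L[ℂ] EllTwo G) :=
  MonoidAlgebra.lift ℂ (EllTwo G →L[ℂ] EllTwo G) G (leftRegular G)

variable {G} in
/-- A bounded operator on `ℓ²(G)`, regarded as an element of the space of bounded operators with
the strong operator topology, i.e. the topology of pointwise convergence. -/
def toSOT (T : EllTwo G →L[ℂ] EllTwo G) : EllTwo G →Lₚₜ[ℂ] EllTwo G :=
  ContinuousLinearMap.toPointwiseConvergenceCLM ℂ (RingHom.id ℂ) (EllTwo G) (EllTwo G) T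

/-- The underlying set of `L(G)`: the closure of the image of `ℂ[G]` in the strong operator
topology. -/
def groupVNSet : Set (EllTwo G →L[ℂ] EllTwo G) :=
  {T | toSOT T ∈ closure (toSOT '' Set.range (groupAlgebraRep G))}

variable {G}

theorem rep_mem_groupVNSet (a : MonoidAlgebra ℂ G) : groupAlgebraRep G a ∈ groupVNSet G := by
  have h : toSOT (groupAlgebraRep G a) ∈ closure (toSOT '' Set.range (groupAlgebraRep G)) :=
    subset_closure ⟨_, ⟨a, rfl⟩, rfl⟩
  exact h

theorem groupVNSet_of_tendsto {ι : Type*} {F : Filter ι} [F.NeBot]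
    {S : ι → EllTwo G →L[ℂ] EllTwo G} {T : EllTwo G →L[ℂ] EllTwo G}
    (hS : ∀ i, S i ∈ groupVNSet G) (h : ∀ ξ, Tendsto (fun i => S i ξ) F (𝓝 (T ξ))) :
    T ∈ groupVNSet G := by
  have h' : Tendsto (fun i => toSOT (S i)) F (𝓝 (toSOT T)) :=
    PointwiseConvergenceCLM.tendsto_iff_forall_tendsto.2 h
  have h'' : toSOT T ∈ closure (toSOT '' Set.range (groupAlgebraRep G)) :=
    isClosed_closure.mem_of_tendsto h' (Eventually.of_forall hS)
  exact h''

theorem exists_filter_of_mem {T : EllTwo G →L[ℂ] EllTwo G} (hT : T ∈ groupVNSet G) :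
    ∃ F : Filter (MonoidAlgebra ℂ G), F.NeBot ∧
      ∀ ξ, Tendsto (fun a => groupAlgebraRep G a ξ) F (𝓝 (T ξ)) := by
  have hT' : toSOT T ∈ closure (toSOT '' Set.range (groupAlgebraRep G)) := hT
  rw [← Set.range_comp] at hT'
  have hne : (comap (toSOT ∘ groupAlgebraRep G) (𝓝 (toSOT T))).NeBot := by
    rw [comap_neBot_iff]
    intro t ht
    obtain ⟨_, hx, ⟨a, rfl⟩⟩ := mem_closure_iff_nhds.1 hT' t ht
    exact ⟨a, hx⟩
  have h : Tendsto (fun a => toSOT (groupAlgebraRep G a))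
      (comap (toSOT ∘ groupAlgebraRep G) (𝓝 (toSOT T))) (𝓝 (toSOT T)) := tendsto_comap
  exact ⟨_, hne, PointwiseConvergenceCLM.tendsto_iff_forall_tendsto.1 h⟩

theorem exists_star_rep (a : MonoidAlgebra ℂ G) :
    ∃ b, star (groupAlgebraRep G a) = groupAlgebraRep G b := by
  induction a using MonoidAlgebra.induction_on with
  | of g => 
    refine ⟨MonoidAlgebra.of ℂ G g⁻¹, ?_⟩
    rw [star_eq_adjoint, eq_comm, eq_adjoint_iff]
    intro ξ η
    simp only [groupAlgebraRep, MonoidAlgebra.lift_of]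
    have h1 : permOp (Equiv.mulLeft g⁻¹) (permOp (Equiv.mulLeft g) η) = η := by
      ext h
      simp [permOp_apply]
    calc inner ℂ (permOp (Equiv.mulLeft g⁻¹) ξ) η
        = inner ℂ (permIsometry (Equiv.mulLeft g⁻¹) ξ)
            (permIsometry (Equiv.mulLeft g⁻¹) (permOp (Equiv.mulLeft g) η)) := by
          rw [show permIsometry (Equiv.mulLeft g⁻¹) (permOp (Equiv.mulLeft g) η) = η from h1]
          rfl
      _ = inner ℂ ξ (permOp (Equiv.mulLeft g) η) := LinearIsometry.inner_map_map _ _ _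
  | add a b ha hb =>
    obtain ⟨a', ha⟩ := ha
    obtain ⟨b', hb⟩ := hb
    exact ⟨a' + b', by rw [map_add, map_add, star_add, ha, hb]⟩
  | smul c a ha =>
    obtain ⟨a', ha⟩ := ha
    exact ⟨star c • a', by rw [map_smul, map_smul, star_smul, ha]⟩

theorem star_mem_groupVNSet {T : EllTwo G →L[ℂ] EllTwo G} (hT : T ∈ groupVNSet G) :
    star T ∈ groupVNSet G := by
  obtain ⟨F, hF, hlim⟩ := exists_filter_of_mem hT
  have key : ∀ p : Finset (EllTwo G) × ℕ, ∃ a, ∀ ξ ∈ p.1,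
      ‖star T ξ - groupAlgebraRep G a ξ‖ < 1 / ((p.2 : ℝ) + 1) := by
    rintro ⟨s, k⟩
    let Φ : MonoidAlgebra ℂ G →ₗ[ℂ] PiLp 2 (fun _ : s => EllTwo G) :=
      { toFun := fun a => WithLp.toLp 2 fun ξ => groupAlgebraRep G a ξ
        map_add' := fun a b => by ext; simp
        map_smul' := fun c a => by ext; simp }
    let v : PiLp 2 (fun _ : s => EllTwo G) := WithLp.toLp 2 fun ξ => star T ξ
    have hv : v ∈ (LinearMap.range Φ).topologicalClosure := by
      rw [← Submodule.orthogonal_orthogonal_eq_closure]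
      intro η hη
      have h1 : inner ℂ η v = ∑ i, inner ℂ (T (η i)) (i : EllTwo G) := by
        rw [PiLp.inner_apply]
        refine Finset.sum_congr rfl fun i _ => ?_
        exact adjoint_inner_right T _ _
      rw [h1]
      have h2 : Tendsto (fun a => ∑ i, inner ℂ (groupAlgebraRep G a (η i)) (i : EllTwo G)) F
          (𝓝 (∑ i, inner ℂ (T (η i)) (i : EllTwo G))) :=
        tendsto_finsetSum _ fun i _ => (hlim (η i)).inner tendsto_const_nhds
      refine tendsto_nhds_unique h2 ?_
      have h3 : ∀ a, ∑ i, inner ℂ (groupAlgebraRep G a (η i)) (i : EllTwo G) = 0 := by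
        intro a
        obtain ⟨b, hb⟩ := exists_star_rep a
        have := Submodule.inner_left_of_mem_orthogonal (LinearMap.mem_range_self Φ b) hη
        rw [PiLp.inner_apply] at this
        rw [← this]
        refine Finset.sum_congr rfl fun i _ => ?_
        change _ = inner ℂ (η i) (groupAlgebraRep G b i)
        rw [← hb]
        exact (adjoint_inner_right (groupAlgebraRep G a) _ _).symm
      simp only [h3]
      exact tendsto_const_nhds
    have := Metric.mem_closure_iff.1 (show v ∈ closure (LinearMap.range Φ : Set _) from hv)
      (1 / ((k : ℝ) + 1)) (by positivity)
    obtain ⟨_, ⟨a, rfl⟩, hlt⟩ := this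
    refine ⟨a, fun ξ hξ => lt_of_le_of_lt ?_ hlt⟩
    rw [dist_eq_norm]
    exact PiLp.norm_apply_le (v - Φ a) ⟨ξ, hξ⟩
  choose a ha using key
  have : (atTop : Filter (Finset (EllTwo G) × ℕ)).NeBot := by
    classical infer_instance
  refine groupVNSet_of_tendsto (F := atTop) (S := fun p => groupAlgebraRep G (a p))
    (fun p => rep_mem_groupVNSet _) fun ξ => ?_
  rw [tendsto_iff_norm_sub_tendsto_zero]
  have hb : Tendsto (fun p : Finset (EllTwo G) × ℕ => 1 / ((p.2 : ℝ) + 1)) atTop (𝓝 0) := by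
    rw [← prod_atTop_atTop_eq]
    exact tendsto_one_div_add_atTop_nhds_zero_nat.comp tendsto_snd
  refine squeeze_zero' (Eventually.of_forall fun _ => norm_nonneg _) ?_ hb
  filter_upwards [eventually_ge_atTop (({ξ} : Finset (EllTwo G)), 0)] with p hp
  rw [norm_sub_rev]
  exact (ha p ξ (hp.1 (Finset.mem_singleton_self ξ))).le

variable (G) in
/-- The group von Neumann algebra `L(G)`, as a `*`-subalgebra of the bounded operators on
`ℓ²(G)`. -/
def groupVN : StarSubalgebra ℂ (EllTwo G →L[ℂ] EllTwo G) where
  carrier := groupVNSet G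
  mul_mem' {T S} hT hS := by
    have h1 : ∀ a, groupAlgebraRep G a * S ∈ groupVNSet G := fun a => by
      obtain ⟨F, hF, hlim⟩ := exists_filter_of_mem hS
      refine groupVNSet_of_tendsto (F := F) (S := fun b => groupAlgebraRep G (a * b))
        (fun b => rep_mem_groupVNSet _) fun ξ => ?_
      simp only [map_mul, mul_apply_eq_comp]
      exact ((groupAlgebraRep G a).continuous.tendsto _).comp (hlim ξ)
    obtain ⟨F, hF, hlim⟩ := exists_filter_of_mem hT
    exact groupVNSet_of_tendsto (F := F) h1 fun ξ => hlim (S ξ)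
  add_mem' {T S} hT hS := by
    have h1 : ∀ a, groupAlgebraRep G a + S ∈ groupVNSet G := fun a => by
      obtain ⟨F, hF, hlim⟩ := exists_filter_of_mem hS
      refine groupVNSet_of_tendsto (F := F) (S := fun b => groupAlgebraRep G (a + b))
        (fun b => rep_mem_groupVNSet _) fun ξ => ?_
      simp only [map_add, add_apply]
      exact (hlim ξ).const_add _
    obtain ⟨F, hF, hlim⟩ := exists_filter_of_mem hT
    exact groupVNSet_of_tendsto (F := F) h1 fun ξ => (hlim ξ).add_const _
  algebraMap_mem' c := by
    rw [← (groupAlgebraRep G).commutes c]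
    exact rep_mem_groupVNSet _
  star_mem' := star_mem_groupVNSet

theorem mem_groupVN {T : EllTwo G →L[ℂ] EllTwo G} : T ∈ groupVN G ↔ T ∈ groupVNSet G := Iff.rfl

theorem groupVN_commute_right {T : EllTwo G →L[ℂ] EllTwo G} (hT : T ∈ groupVN G) (g : G)
    (ξ : EllTwo G) : T (permOp (Equiv.mulRight g) ξ) = permOp (Equiv.mulRight g) (T ξ) := by
  have h : ∀ a, groupAlgebraRep G a (permOp (Equiv.mulRight g) ξ) =
      permOp (Equiv.mulRight g) (groupAlgebraRep G a ξ) := by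
    intro a
    induction a using MonoidAlgebra.induction_on with
    | of h =>
      simp only [groupAlgebraRep, MonoidAlgebra.lift_of]
      ext k
      change ξ _ = ξ _
      simp [mul_assoc]
    | add a b ha hb => simp only [map_add, add_apply, ha, hb]
    | smul c a ha => simp only [map_smul, smul_apply, ha]
  obtain ⟨F, hF, hlim⟩ := exists_filter_of_mem hT
  refine tendsto_nhds_unique (hlim _) ?_
  simp only [h]
  exact ((permOp (Equiv.mulRight g)).continuous.tendsto _).comp (hlim ξ)

theorem groupVN_apply_basisVec {T : EllTwo G →L[ℂ] EllTwo G} (hT : T ∈ groupVN G) (g : G) :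
    T (basisVec g) = permOp (Equiv.mulRight g) (T (basisVec 1)) := by
  rw [← groupVN_commute_right hT, permOp_basisVec]; simp

theorem groupVN_eq_zero {T : EllTwo G →L[ℂ] EllTwo G} (hT : T ∈ groupVN G)
    (h : T (basisVec 1) = 0) : T = 0 := by
  have hd : Dense (Submodule.span ℂ (Set.range (basisVec : G → EllTwo G)) : Set (EllTwo G)) :=
    Submodule.dense_iff_topologicalClosure_eq_top.2 span_basisVec
  refine ContinuousLinearMap.ext_on hd ?_
  rintro _ ⟨g, rfl⟩
  rw [groupVN_apply_basisVec hT, h, map_zero]; rfl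

theorem groupVN_star_apply {T : EllTwo G →L[ℂ] EllTwo G} (hT : T ∈ groupVN G) (g : G) :
    (star T (basisVec 1)) g = star ((T (basisVec 1)) g⁻¹) := by
  rw [← inner_basisVec, star_eq_adjoint, adjoint_inner_right, groupVN_apply_basisVec hT,
    ← inner_conj_symm, inner_basisVec, permOp_apply]
  simp

theorem groupVN_norm_star {T : EllTwo G →L[ℂ] EllTwo G} (hT : T ∈ groupVN G) :
    ‖star T (basisVec 1)‖ = ‖T (basisVec 1)‖ := by
  have h2 : 0 < (2 : ℝ≥0∞).toReal := by norm_num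
  rw [lp.norm_eq_tsum_rpow h2, lp.norm_eq_tsum_rpow h2]
  congr 1
  simp only [groupVN_star_apply hT, norm_star]
  exact (Equiv.inv G).tsum_eq (fun i => ‖(T (basisVec 1)) i‖ ^ (2 : ℝ≥0∞).toReal)

/-- The trace `tr(T) = ⟨T δ_e, δ_e⟩`. (The inner product of Mathlib is linear in the second
argument.) -/
def vnTrace (T : EllTwo G →L[ℂ] EllTwo G) : ℂ := inner ℂ (basisVec 1) (T (basisVec 1))

/-- The norm `‖T‖₂ = √tr(T* T)`. -/
def twoNorm (T : EllTwo G →L[ℂ] EllTwo G) : ℝ := √(vnTrace (star T * T)).re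

theorem twoNorm_eq (T : EllTwo G →L[ℂ] EllTwo G) : twoNorm T = ‖T (basisVec 1)‖ := by
  rw [twoNorm, vnTrace, mul_apply_eq_comp, star_eq_adjoint, adjoint_inner_right,
    inner_self_eq_norm_sq_to_K]
  norm_cast
  exact Real.sqrt_sq (norm_nonneg _)

theorem twoNorm_le (T : EllTwo G →L[ℂ] EllTwo G) : twoNorm T ≤ ‖T‖ := by
  rw [twoNorm_eq]
  simpa [norm_basisVec] using T.le_opNorm (basisVec 1)

theorem norm_vnTrace_le (T : EllTwo G →L[ℂ] EllTwo G) : ‖vnTrace T‖ ≤ twoNorm T := by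
  rw [twoNorm_eq, vnTrace]
  simpa [norm_basisVec] using norm_inner_le_norm (𝕜 := ℂ) (basisVec 1) (T (basisVec 1))

theorem twoNorm_add_le (S T : EllTwo G →L[ℂ] EllTwo G) :
    twoNorm (S + T) ≤ twoNorm S + twoNorm T := by
  simp only [twoNorm_eq]; exact norm_add_le _ _

theorem twoNorm_neg (S : EllTwo G →L[ℂ] EllTwo G) : twoNorm (-S) = twoNorm S := by
  simp only [twoNorm_eq]; exact norm_neg _

theorem twoNorm_smul (c : ℂ) (S : EllTwo G →L[ℂ] EllTwo G) :
    twoNorm (c • S) = ‖c‖ * twoNorm S := by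
  simp only [twoNorm_eq]; exact norm_smul c (S (basisVec 1))

theorem twoNorm_star {T : EllTwo G →L[ℂ] EllTwo G} (hT : T ∈ groupVN G) :
    twoNorm (star T) = twoNorm T := by
  rw [twoNorm_eq, twoNorm_eq, groupVN_norm_star hT]

theorem twoNorm_mul_le_left (S T : EllTwo G →L[ℂ] EllTwo G) :
    twoNorm (S * T) ≤ ‖S‖ * twoNorm T := by
  simp only [twoNorm_eq]; exact S.le_opNorm _

theorem twoNorm_mul_le_right {S T : EllTwo G →L[ℂ] EllTwo G} (hS : S ∈ groupVN G)
    (hT : T ∈ groupVN G) : twoNorm (S * T) ≤ twoNorm S * ‖T‖ := by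
  rw [← twoNorm_star (mul_mem hS hT), star_mul, mul_comm, ← twoNorm_star hS, ← norm_star T]
  exact twoNorm_mul_le_left _ _

variable (G) in
/-- The sort of radius `n` of `L(G)`: its closed operator norm ball of radius `n`. -/
@[ext] structure VNBall (n : ℕ+) where
  op : EllTwo G →L[ℂ] EllTwo G
  mem : op ∈ groupVN G
  norm_le : ‖op‖ ≤ n

/-- The metric of each sort is the one induced by `‖·‖₂`. -/
instance vnBallMetric (n : ℕ+) : MetricSpace (VNBall G n) where
  dist x y := twoNorm (x.op - y.op)
  dist_self x := by simp [twoNorm_eq]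
  dist_comm x y := by rw [← twoNorm_neg, neg_sub]
  dist_triangle x y z := by
    have := twoNorm_add_le (x.op - y.op) (y.op - z.op)
    rwa [sub_add_sub_cancel] at this
  eq_of_dist_eq_zero {x y} h := by
    have h' : twoNorm (x.op - y.op) = 0 := h
    rw [twoNorm_eq, norm_eq_zero] at h'
    exact VNBall.ext (sub_eq_zero.1 (groupVN_eq_zero (sub_mem x.mem y.mem) h'))

theorem vnBall_dist {n : ℕ+} (x y : VNBall G n) : dist x y = twoNorm (x.op - y.op) := rfl

theorem vnBall_cauchySeq_apply {n : ℕ+} {u : ℕ → VNBall G n} (hu : CauchySeq u) (ξ : EllTwo G) :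
    CauchySeq fun k => (u k).op ξ := by
  have hd : Dense (Submodule.span ℂ (Set.range (basisVec : G → EllTwo G)) : Set (EllTwo G)) :=
    Submodule.dense_iff_topologicalClosure_eq_top.2 span_basisVec
  have hspan : ∀ η ∈ Submodule.span ℂ (Set.range (basisVec : G → EllTwo G)),
      CauchySeq fun k => (u k).op η := by
    intro η hη
    induction hη using Submodule.span_induction with
    | mem η h =>
      obtain ⟨g, rfl⟩ := h
      rw [Metric.cauchySeq_iff'] at hu ⊢
      intro ε hε
      obtain ⟨N, hN⟩ := hu ε hε
      refine ⟨N, fun k hk => ?_⟩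
      have := hN k hk
      rw [vnBall_dist, twoNorm_eq] at this
      rw [dist_eq_norm, ← sub_apply,
        groupVN_apply_basisVec (sub_mem (u k).mem (u N).mem), norm_permOp]
      exact this
    | zero => simpa using cauchySeq_const (0 : EllTwo G)
    | add x y _ _ hx hy =>
      simp only [map_add]
      exact hx.add hy
    | smul c x _ hx =>
      simp only [map_smul]
      exact hx.map (uniformContinuous_const_smul c)
  rw [Metric.cauchySeq_iff']
  intro ε hε
  have hn : (0 : ℝ) < n := by exact_mod_cast n.pos
  obtain ⟨η, hη, hlt⟩ := Metric.dense_iff.1 hd ξ (ε / (4 * n)) (by positivity)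
  obtain ⟨N, hN⟩ := Metric.cauchySeq_iff'.1 (hspan _ hlt) (ε / 2) (by positivity)
  refine ⟨N, fun k hk => ?_⟩
  have h1 : ∀ j, dist ((u j).op ξ) ((u j).op η) ≤ ε / 4 := fun j => by
    rw [dist_eq_norm, ← map_sub]
    calc ‖(u j).op (ξ - η)‖ ≤ n * (ε / (4 * n)) := by
          refine ((u j).op.le_of_opNorm_le (u j).norm_le _).trans ?_
          gcongr
          rw [← dist_eq_norm, dist_comm]
          exact (Metric.mem_ball.1 hη).le
      _ = ε / 4 := by field_simp
  have h2 := hN k hk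
  have h3 := dist_triangle4 ((u k).op ξ) ((u k).op η) ((u N).op η) ((u N).op ξ)
  have h4 := h1 k
  have h5 := h1 N
  rw [dist_comm] at h5
  linarith

theorem vnBall_complete (n : ℕ+) : CompleteSpace (VNBall G n) := by
  refine Metric.complete_of_cauchySeq_tendsto fun u hu => ?_
  choose f hf using fun ξ => cauchySeq_tendsto_of_complete (vnBall_cauchySeq_apply hu ξ)
  let T₀ : EllTwo G →ₗ[ℂ] EllTwo G :=
    { toFun := f
      map_add' := fun x y => tendsto_nhds_unique (hf (x + y))
        (by simpa only [map_add] using (hf x).add (hf y))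
      map_smul' := fun c x => tendsto_nhds_unique (hf (c • x))
        (by simpa only [map_smul, RingHom.id_apply] using (hf x).const_smul c) }
  have hb : ∀ ξ, ‖T₀ ξ‖ ≤ n * ‖ξ‖ := fun ξ =>
    le_of_tendsto (hf ξ).norm
      (Eventually.of_forall fun k => (u k).op.le_of_opNorm_le (u k).norm_le ξ)
  refine ⟨⟨T₀.mkContinuous n hb, ?_, ?_⟩, ?_⟩
  · exact groupVNSet_of_tendsto (F := atTop) (fun k => (u k).mem) hf
  · exact LinearMap.mkContinuous_norm_le _ (by positivity) _
  · rw [tendsto_iff_dist_tendsto_zero]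
    simp only [vnBall_dist, twoNorm_eq]
    exact tendsto_iff_norm_sub_tendsto_zero.1 (hf (basisVec 1))

/-- The interpretation of the function symbols in `L(G)`. -/
def vnFn : ∀ {k dom cod}, VNFunc k dom cod → (∀ j : Fin k, VNBall G (dom j)) → VNBall G cod
  | _, _, _, .zero, _ => ⟨0, zero_mem _, by simp⟩
  | _, _, _, .one, _ => ⟨1, one_mem _, by rw [PNat.one_coe, Nat.cast_one]; exact norm_id_le⟩
  | _, _, _, .incl _ _ h, x => ⟨(x 0).op, (x 0).mem, (x 0).norm_le.trans (by exact_mod_cast h)⟩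
  | _, _, _, .add _ _, x => ⟨(x 0).op + (x 1).op, add_mem (x 0).mem (x 1).mem, by
      refine (norm_add_le _ _).trans ?_
      push_cast
      exact add_le_add (x 0).norm_le (x 1).norm_le⟩
  | _, _, _, .mul _ _, x => ⟨(x 0).op * (x 1).op, mul_mem (x 0).mem (x 1).mem, by
      refine (norm_mul_le _ _).trans ?_
      push_cast
      exact mul_le_mul (x 0).norm_le (x 1).norm_le (norm_nonneg _) (by positivity)⟩
  | _, _, _, .smul c _, x => ⟨c • (x 0).op, SMulMemClass.smul_mem c (x 0).mem, by
      rw [norm_smul, PNat.mul_coe, Nat.cast_mul]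
      refine mul_le_mul ?_ (x 0).norm_le (norm_nonneg _) (by positivity)
      refine (Nat.le_ceil _).trans (Nat.cast_le.2 ?_)
      rw [Nat.toPNat'_coe]
      split_ifs <;> omega⟩
  | _, _, _, .star _, x => ⟨star (x 0).op, star_mem (x 0).mem, by
      exact (norm_star (x 0).op).trans_le (x 0).norm_le⟩

/-- The interpretation of the predicate symbols in `L(G)`. -/
def vnPr : ∀ {k dom}, VNPred k dom → (∀ j : Fin k, VNBall G (dom j)) → ℝ
  | _, _, .reTr _, x => (vnTrace (x 0).op).re
  | _, _, .imTr _, x => (vnTrace (x 0).op).im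

theorem vnFn_obeys {k dom cod} (f : VNFunc k dom cod) (x y : ∀ j : Fin k, VNBall G (dom j)) :
    nndist (vnFn f x) (vnFn f y) ≤ f.mod fun j => nndist (x j) (y j) := by
  rw [← NNReal.coe_le_coe, coe_nndist]
  cases f with
  | zero => exact (dist_self _).le
  | one => exact (dist_self _).le
  | incl m n h => exact le_refl (twoNorm ((x 0).op - (y 0).op))
  | add m n =>
    change twoNorm ((x 0).op + (x 1).op - ((y 0).op + (y 1).op)) ≤
      twoNorm ((x 0).op - (y 0).op) + twoNorm ((x 1).op - (y 1).op)
    rw [add_sub_add_comm]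
    exact twoNorm_add_le _ _
  | mul m n =>
    change twoNorm ((x 0).op * (x 1).op - (y 0).op * (y 1).op) ≤
      n * twoNorm ((x 0).op - (y 0).op) + m * twoNorm ((x 1).op - (y 1).op)
    have h1 : (x 0).op * (x 1).op - (y 0).op * (y 1).op =
        ((x 0).op - (y 0).op) * (x 1).op + (y 0).op * ((x 1).op - (y 1).op) := by
      rw [sub_mul, mul_sub, sub_add_sub_cancel]
    have h2 : ‖(x 1).op‖ ≤ n := (x 1).norm_le
    have h3 : ‖(y 0).op‖ ≤ m := (y 0).norm_le
    rw [h1]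
    refine (twoNorm_add_le _ _).trans (add_le_add ?_ ?_)
    · refine (twoNorm_mul_le_right (sub_mem (x 0).mem (y 0).mem) (x 1).mem).trans ?_
      rw [mul_comm]
      exact mul_le_mul_of_nonneg_right h2 (Real.sqrt_nonneg _)
    · exact (twoNorm_mul_le_left _ _).trans (mul_le_mul_of_nonneg_right h3 (Real.sqrt_nonneg _))
  | smul c n =>
    change twoNorm (c • (x 0).op - c • (y 0).op) ≤ ‖c‖ * twoNorm ((x 0).op - (y 0).op)
    rw [← smul_sub, twoNorm_smul]
  | star n =>
    change twoNorm (star (x 0).op - star (y 0).op) ≤ twoNorm ((x 0).op - (y 0).op)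
    rw [← star_sub, twoNorm_star (sub_mem (x 0).mem (y 0).mem)]

theorem vnPr_mem {k dom} (P : VNPred k dom) (x : ∀ j : Fin k, VNBall G (dom j)) :
    vnPr P x ∈ Set.Icc (-P.radius) P.radius := by
  rw [Set.mem_Icc, ← abs_le]
  have h : ∀ {n : ℕ+} (y : VNBall G n), ‖vnTrace y.op‖ ≤ n := fun y =>
    (norm_vnTrace_le _).trans ((twoNorm_le _).trans y.norm_le)
  cases P with
  | reTr n => exact (Complex.abs_re_le_norm _).trans (h (x 0))
  | imTr n => exact (Complex.abs_im_le_norm _).trans (h (x 0))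

theorem vnTrace_sub (S T : EllTwo G →L[ℂ] EllTwo G) :
    vnTrace (S - T) = vnTrace S - vnTrace T := by
  simp only [vnTrace, sub_apply, inner_sub_right]

theorem vnPr_obeys {k dom} (P : VNPred k dom) (x y : ∀ j : Fin k, VNBall G (dom j)) :
    nndist (vnPr P x) (vnPr P y) ≤ P.mod fun j => nndist (x j) (y j) := by
  rw [← NNReal.coe_le_coe, coe_nndist, Real.dist_eq]
  cases P with
  | reTr n =>
    change |(vnTrace (x 0).op).re - (vnTrace (y 0).op).re| ≤ twoNorm ((x 0).op - (y 0).op)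
    rw [← Complex.sub_re, ← vnTrace_sub]
    exact (Complex.abs_re_le_norm _).trans (norm_vnTrace_le _)
  | imTr n =>
    change |(vnTrace (x 0).op).im - (vnTrace (y 0).op).im| ≤ twoNorm ((x 0).op - (y 0).op)
    rw [← Complex.sub_im, ← vnTrace_sub]
    exact (Complex.abs_im_le_norm _).trans (norm_vnTrace_le _)

theorem vnBall_dist_le (n : ℕ+) (x y : VNBall G n) : dist x y ≤ ((2 * (n : ℝ≥0) : ℝ≥0) : ℝ) := by
  refine (twoNorm_le _).trans ((norm_sub_le _ _).trans ?_)
  push_cast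
  rw [two_mul]
  exact add_le_add x.norm_le y.norm_le

variable (G) in
/-- `L(G)` as a metric structure in the language of tracial von Neumann algebras. -/
def groupVNStructure : MetricStructure vnLanguage where
  Carrier := VNBall G
  metric := vnBallMetric
  complete := vnBall_complete
  dist_le_diam := vnBall_dist_le
  fn := vnFn
  fn_obeys := vnFn_obeys
  pr := vnPr
  pr_mem := vnPr_mem
  pr_obeys := vnPr_obeys

end GroupVN

end

/-!
A finite tuple of group elements in `G` and one in `H` with the same quantifier-free type generate
isomorphic subgroups; let `R ≤ G × H` be the graph of the isomorphism. Along `R`, a linear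
combination of `u_g`'s is matched with the same linear combination of the corresponding `u_h`'s.
Matched operators are closed under the `*`-algebra operations and have equal traces, so every atomic
formula takes equal values at tuples of matched operators (`atomic_eval_eq`). They also have equal
operator norms (`norm_eq_of_mem_matchedOps`), because the trace is faithful: the norm of `T` is
controlled by the moments of `T* T`. Hence the partner of an element of a ball is in the same ball.

An arbitrary element of a ball of `L(G)` is approximated in `‖·‖₂` by an element of `ℂ[G]` in the
same ball, by the Kaplansky density theorem (`exists_groupAlgebra_twoNorm_sub_lt`). In the presence
of a trace it has a short proof: clipping the singular values of an operator at `1` is the nearest-point projection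
onto the unit ball for `‖·‖₂` (`exists_twoNorm_nearest`), so clipping an arbitrary approximation
from `ℂ[G]` does not make it worse.

The theorem follows by induction on the rank (`bfDist_le`): if two tuples are within distances `u`
and `v` of tuples matched along `R`, then their back-and-forth pseudo-distance is at most
`Ω(u) + Ω(v)`. A move in `L(G)` is first approximated by group algebra elements, at a cost in `Ω`
that can be made arbitrarily small; the finitely many group elements involved are then played in the
classical game, and the answer in `H` yields matched operators in `L(H)`.
-/

open scoped NNReal ENNReal

/-! ### The trace and the reduced group `C*`-algebra -/

theorem vnTrace_mul_comm {G : Type*} [Group G] {S T : EllTwo G →L[ℂ] EllTwo G}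
    (hS : S ∈ groupVN G) (hT : T ∈ groupVN G) : vnTrace (S * T) = vnTrace (T * S) := by
  have key : ∀ {S T : EllTwo G →L[ℂ] EllTwo G}, S ∈ groupVN G →
      vnTrace (S * T) = ∑' g, S (basisVec 1) g⁻¹ * T (basisVec 1) g := by
    intro S T hS
    rw [vnTrace, mul_apply_eq_comp, ← ContinuousLinearMap.adjoint_inner_left,
      ← ContinuousLinearMap.star_eq_adjoint, lp.inner_eq_tsum]
    refine tsum_congr fun g => ?_
    rw [groupVN_star_apply hS, RCLike.inner_apply, mul_comm]
    simp
  rw [key hS, key hT, ← (Equiv.inv G).tsum_eq]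
  exact tsum_congr fun g => by simp [mul_comm]

theorem vnTrace_star_mul {G : Type*} [Group G] (S T : EllTwo G →L[ℂ] EllTwo G) :
    vnTrace (star S * T) = inner ℂ (S (basisVec 1)) (T (basisVec 1)) := by
  rw [vnTrace, mul_apply_eq_comp, ContinuousLinearMap.star_eq_adjoint,
    ContinuousLinearMap.adjoint_inner_right]

/-- The norm closure of `ℂ[G]` in the bounded operators on `ℓ²(G)`, that is, the reduced group
`C*`-algebra. -/
noncomputable def reducedGroupCStar (G : Type*) [Group G] :
    StarSubalgebra ℂ (EllTwo G →L[ℂ] EllTwo G) :=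
  StarSubalgebra.topologicalClosure
    { (groupAlgebraRep G).range with
      star_mem' := by
        rintro _ ⟨a, rfl⟩
        obtain ⟨b, hb⟩ := exists_star_rep a
        exact ⟨b, hb.symm⟩ }

theorem mem_reducedGroupCStar {G : Type*} [Group G] {T : EllTwo G →L[ℂ] EllTwo G} :
    T ∈ reducedGroupCStar G ↔ T ∈ closure (Set.range (groupAlgebraRep G)) := Iff.rfl

open Filter Topology in
theorem reducedGroupCStar_le {G : Type*} [Group G] : reducedGroupCStar G ≤ groupVN G := by
  intro T hT
  obtain ⟨u, hu, hlim⟩ := mem_closure_iff_seq_limit.1 (mem_reducedGroupCStar.1 hT)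
  refine groupVNSet_of_tendsto (F := atTop) (S := u) (fun k => ?_) fun ξ => ?_
  · obtain ⟨a, ha⟩ := hu k
    exact ha ▸ rep_mem_groupVNSet a
  · exact ((ContinuousLinearMap.apply ℂ (EllTwo G) ξ).continuous.tendsto T).comp hlim

/-! ### Clipping singular values -/

/-- For `s = σ²`, where `σ ≥ 0` is a singular value, the factor `1 / max(1, σ)` that clips `σ` at
`1`. -/
noncomputable def clipFactor (s : ℝ) : ℝ := (max 1 √s)⁻¹

/-- For `s = σ²`, where `σ ≥ 0` is a singular value, the square root of the excess `(σ - 1)₊`; the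
outer `Real.sqrt` is `0` at negative arguments. -/
noncomputable def clipExcess (s : ℝ) : ℝ := √(√s - 1)

theorem continuous_clipFactor : Continuous clipFactor := by
  unfold clipFactor
  exact (continuous_const.max Real.continuous_sqrt).inv₀ fun s =>
    (lt_of_lt_of_le one_pos (le_max_left _ _)).ne'

theorem continuous_clipExcess : Continuous clipExcess := by
  unfold clipExcess; fun_prop

theorem clipExcess_mul_clipFactor_sq {s : ℝ} (hs : 0 ≤ s) :
    clipExcess s * (clipFactor s * (s * clipFactor s)) = clipExcess s := by
  unfold clipExcess clipFactor
  rcases le_total √s 1 with h | h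
  · rw [Real.sqrt_eq_zero_of_nonpos (by linarith)]; simp
  · have h0 : √s ≠ 0 := by positivity
    rw [max_eq_right h]
    have : (√s)⁻¹ * (s * (√s)⁻¹) = 1 := by
      nth_rewrite 2 [← Real.mul_self_sqrt hs]
      field_simp
    rw [this, mul_one]

theorem one_sub_clipFactor (s : ℝ) :
    1 - clipFactor s = clipExcess s * clipFactor s * clipExcess s := by
  unfold clipExcess clipFactor
  rcases le_total √s 1 with h | h
  · rw [max_eq_left h, Real.sqrt_eq_zero_of_nonpos (x := √s - 1) (by linarith)]; simp
  · have h0 : √s ≠ 0 := by positivity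
    rw [max_eq_right h, mul_right_comm, Real.mul_self_sqrt (by linarith)]
    field_simp

theorem clipFactor_mul_mul_le {s : ℝ} (hs : 0 ≤ s) :
    ‖clipFactor s * (s * clipFactor s)‖ ≤ 1 := by
  unfold clipFactor
  have h1 : 0 < max 1 √s := lt_of_lt_of_le one_pos (le_max_left _ _)
  have h2 : s ≤ max 1 √s * max 1 √s := by
    nth_rewrite 1 [← Real.mul_self_sqrt hs]
    gcongr <;> exact le_max_right _ _
  rw [Real.norm_of_nonneg (by positivity)]
  calc _ = s / (max 1 √s * max 1 √s) := by field_simp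
    _ ≤ 1 := by rw [div_le_one (by positivity)]; exact h2

/-- The functional calculus behind clipping the singular values of `a` at `1`: with `s = a* a`, the
element `h` is the clipping factor, so that `‖a h‖ ≤ 1`, and `k²` is the excess `(√s - 1)₊`. -/
theorem exists_clip {A : Type*} [CStarAlgebra A] (B : StarSubalgebra ℂ A)
    [IsClosed (B : Set A)] {a : A} (ha : a ∈ B) :
    ∃ h ∈ B, ∃ k ∈ B, star h = h ∧ star k = k ∧ ‖a * h‖ ≤ 1 ∧ h * k = k * h ∧
      1 - h = k * h * k ∧ k * (h * (star a * a * h)) = k := by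
  have hsB : star a * a ∈ B := mul_mem (star_mem ha) ha
  have hspec : ∀ x ∈ spectrum ℝ (star a * a), 0 ≤ x := fun x hx =>
    spectrum_star_mul_self_nonneg x hx
  have hc := continuous_clipFactor
  have kc := continuous_clipExcess
  generalize hs : star a * a = s at hspec hsB
  have hsa : IsSelfAdjoint s := hs ▸ IsSelfAdjoint.star_mul_self a
  have hhs : star (cfc clipFactor s) = cfc clipFactor s := (cfc_predicate clipFactor s).star_eq
  have hhsh : cfc clipFactor s * (s * cfc clipFactor s) =
      cfc (fun x => clipFactor x * (x * clipFactor x)) s := by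
    rw [cfc_mul clipFactor (fun x => x * clipFactor x) s,
      cfc_mul (fun x => x) clipFactor s, cfc_id' ℝ s]
  refine ⟨cfc clipFactor s, cfc_mem _ hsB, cfc clipExcess s, cfc_mem _ hsB,
    hhs, (cfc_predicate clipExcess s).star_eq, ?_, cfc_commute_cfc _ _ _, ?_, ?_⟩
  · rw [← sq_le_one_iff₀ (norm_nonneg _), sq, ← CStarRing.norm_star_mul_self, star_mul, hhs,
      mul_assoc, ← mul_assoc (star a), hs, hhsh]
    exact norm_cfc_le zero_le_one fun x hx => clipFactor_mul_mul_le (hspec x hx)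
  · rw [← cfc_mul clipExcess clipFactor s, ← cfc_mul (fun x => clipExcess x * clipFactor x) _ s,
      ← cfc_one ℝ s, ← cfc_sub 1 clipFactor s]
    exact cfc_congr fun x _ => one_sub_clipFactor x
  · rw [hhsh, ← cfc_mul clipExcess _ s]
    exact cfc_congr fun x hx => clipExcess_mul_clipFactor_sq (hspec x hx)

/-! ### Kaplansky density for `‖·‖₂` -/

/-- Clipping the singular values of `a` at `1` is the nearest-point projection onto the operator
norm unit ball for `‖·‖₂`. With `P = a h` and `⟨x, y⟩ = tr (x* y)` this amounts to
`Re ⟨a - P, T - P⟩ ≤ 0` for all `T` in the ball, which holds because `⟨a - P, P⟩ = tr (k²)` and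
`Re ⟨a - P, T⟩ ≤ tr (k²)`. -/
theorem exists_twoNorm_nearest {G : Type*} [Group G] {a : EllTwo G →L[ℂ] EllTwo G}
    (ha : a ∈ reducedGroupCStar G) :
    ∃ P ∈ reducedGroupCStar G, ‖P‖ ≤ 1 ∧
      ∀ T ∈ groupVN G, ‖T‖ ≤ 1 → twoNorm (T - P) ≤ twoNorm (T - a) := by
  have : IsClosed (reducedGroupCStar G : Set (EllTwo G →L[ℂ] EllTwo G)) :=
    StarSubalgebra.isClosed_topologicalClosure _
  obtain ⟨h, hh, k, hk, hhs, hks, hn, hhk, e2, e1⟩ := exists_clip (reducedGroupCStar G) ha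
  refine ⟨a * h, mul_mem ha hh, hn, fun T hT hT1 => ?_⟩
  have hV {x} (hx : x ∈ reducedGroupCStar G) : x ∈ groupVN G := reducedGroupCStar_le hx
  have hd : a - a * h = a * k * h * k := by
    rw [← mul_one_sub, e2]; simp only [mul_assoc]
  -- `⟨a - a h, a h⟩ = tr (k²)`
  have h1 : vnTrace (star (a - a * h) * (a * h)) = vnTrace (k * k) := by
    have : star (a - a * h) * (a * h) = k * (h * k * star a * (a * h)) := by
      rw [hd]; simp only [star_mul, hhs, hks, mul_assoc]
    rw [this, vnTrace_mul_comm (hV hk)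
      (hV (mul_mem (mul_mem (mul_mem hh hk) (star_mem ha)) (mul_mem ha hh)))]
    have : h * k * star a * (a * h) * k = k * (h * (star a * a * h)) * k := by
      rw [hhk]; simp only [mul_assoc]
    rw [this, e1]
  have h3 : ∀ S : EllTwo G →L[ℂ] EllTwo G, twoNorm S ^ 2 = (vnTrace (star S * S)).re := by
    intro S
    rw [twoNorm_eq, vnTrace_star_mul, inner_self_eq_norm_sq_to_K]
    norm_cast
  -- `⟨a - a h, T⟩ = ⟨a k h, T k⟩`, to which Cauchy-Schwarz applies with `‖a k h‖₂ = ‖k‖₂`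
  have h2 : (vnTrace (star (a - a * h) * T)).re ≤ (vnTrace (k * k)).re := by
    have e : star (a - a * h) * T = k * (h * k * star a * T) := by
      rw [hd]; simp only [star_mul, hhs, hks, mul_assoc]
    have e' : h * k * star a * T * k = star (a * k * h) * (T * k) := by
      simp only [star_mul, hhs, hks, mul_assoc]
    have n1 : twoNorm (a * k * h) = twoNorm k := by
      have : twoNorm (a * k * h) ^ 2 = twoNorm k ^ 2 := by
        rw [h3, h3, hks]
        have : star (a * k * h) * (a * k * h) = k * (h * (star a * a * h)) * k := by
          simp only [star_mul, hhs, hks, mul_assoc]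
          rw [← hhk, ← mul_assoc h k, hhk]; simp only [mul_assoc]
        rw [this, e1]
      exact (sq_eq_sq₀ (Real.sqrt_nonneg _) (Real.sqrt_nonneg _)).1 this
    rw [e, vnTrace_mul_comm (hV hk)
      (mul_mem (hV (mul_mem (mul_mem hh hk) (star_mem ha))) hT), e', vnTrace_star_mul]
    calc _ ≤ ‖(a * k * h) (basisVec 1)‖ * ‖(T * k) (basisVec 1)‖ :=
          (Complex.re_le_norm _).trans (norm_inner_le_norm _ _)
      _ = twoNorm k * twoNorm (T * k) := by rw [← twoNorm_eq, ← twoNorm_eq, n1]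
      _ ≤ twoNorm k * (1 * twoNorm k) := by
          gcongr
          · exact Real.sqrt_nonneg _
          · exact (twoNorm_mul_le_left T k).trans
              (mul_le_mul_of_nonneg_right hT1 (Real.sqrt_nonneg _))
      _ = _ := by rw [one_mul, ← sq, h3, hks]
  refine (sq_le_sq₀ (Real.sqrt_nonneg _) (Real.sqrt_nonneg _)).1 ?_
  change twoNorm _ ^ 2 ≤ twoNorm _ ^ 2
  rw [twoNorm_eq, twoNorm_eq]
  have h4 : (T - a) (basisVec 1) = (T - a * h) (basisVec 1) - (a - a * h) (basisVec 1) := by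
    simp
  rw [h4, @norm_sub_sq ℂ]
  have h5 : RCLike.re (inner ℂ ((T - a * h) (basisVec 1)) ((a - a * h) (basisVec 1))) ≤ 0 := by
    rw [inner_re_symm, ← vnTrace_star_mul, mul_sub, vnTrace_sub, h1]
    simpa using h2
  nlinarith [sq_nonneg ‖(a - a * h) (basisVec 1)‖]

/-- The Kaplansky density theorem for `ℂ[G] ⊆ L(G)`, with respect to `‖·‖₂`. -/
theorem exists_groupAlgebra_twoNorm_sub_lt {G : Type*} [Group G]
    {T : EllTwo G →L[ℂ] EllTwo G} (hT : T ∈ groupVN G) {r : ℝ} (hr : 0 < r) (hTr : ‖T‖ ≤ r)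
    {ε : ℝ} (hε : 0 < ε) :
    ∃ b, ‖groupAlgebraRep G b‖ ≤ r ∧ twoNorm (T - groupAlgebraRep G b) < ε := by
  obtain ⟨η, hη, hηε⟩ : ∃ η > 0, r * (3 * η) < ε :=
    ⟨ε / (4 * r), by positivity, by field_simp; norm_num⟩
  set T' : EllTwo G →L[ℂ] EllTwo G := ((r⁻¹ : ℝ) : ℂ) • T with hT'
  have hrT : T = (r : ℂ) • T' := by
    rw [hT', smul_smul, ← Complex.ofReal_mul, mul_inv_cancel₀ hr.ne']; simp
  have hT'V : T' ∈ groupVN G := SMulMemClass.smul_mem _ hT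
  have hT'1 : ‖T'‖ ≤ 1 := by
    rw [hT', norm_smul, Complex.norm_real, Real.norm_of_nonneg (by positivity)]
    exact (inv_mul_le_iff₀ hr).2 (by simpa using hTr)
  obtain ⟨F, hF, hlim⟩ := exists_filter_of_mem hT'V
  obtain ⟨a, ha⟩ := ((Metric.tendsto_nhds.1 (hlim (basisVec 1))) η hη).exists
  have ha' : twoNorm (T' - groupAlgebraRep G a) < η := by
    rwa [twoNorm_eq, sub_apply, ← dist_eq_norm, dist_comm]
  obtain ⟨P, hP, hP1, hPT⟩ := exists_twoNorm_nearest
    (mem_reducedGroupCStar.2 (subset_closure ⟨a, rfl⟩))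
  obtain ⟨_, ⟨b, rfl⟩, hb⟩ := Metric.mem_closure_iff.1 (mem_reducedGroupCStar.1 hP) η hη
  rw [dist_eq_norm] at hb
  have hbn : ‖groupAlgebraRep G b‖ ≤ 1 + η := by
    have := norm_le_norm_add_norm_sub' (groupAlgebraRep G b) P
    rw [norm_sub_rev] at this
    linarith
  have h1 : (0 : ℝ) < 1 + η := by positivity
  -- `b` may leave the unit ball by `η`, hence the rescaling
  refine ⟨((r / (1 + η) : ℝ) : ℂ) • b, ?_, ?_⟩
  · rw [map_smul, norm_smul, Complex.norm_real, Real.norm_of_nonneg (by positivity)]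
    calc _ ≤ r / (1 + η) * (1 + η) := by gcongr
      _ = r := by field_simp
  · have e : T - groupAlgebraRep G (((r / (1 + η) : ℝ) : ℂ) • b) =
        (r : ℂ) • ((T' - P) + ((P - groupAlgebraRep G b) +
          ((η / (1 + η) : ℝ) : ℂ) • groupAlgebraRep G b)) := by
      have : ((r / (1 + η) : ℝ) : ℂ) = r * (1 - ((η / (1 + η) : ℝ) : ℂ)) := by
        rw [← Complex.ofReal_one, ← Complex.ofReal_sub, ← Complex.ofReal_mul]
        congr 1
        field_simp
        ring
      rw [map_smul, this, mul_smul, ← sub_eq_zero, hrT]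
      module
    have t3 : twoNorm (((η / (1 + η) : ℝ) : ℂ) • groupAlgebraRep G b) ≤ η := by
      rw [twoNorm_smul, Complex.norm_real, Real.norm_of_nonneg (by positivity)]
      calc _ ≤ η / (1 + η) * (1 + η) := by gcongr; exact (twoNorm_le _).trans hbn
        _ = η := by field_simp
    rw [e, twoNorm_smul, Complex.norm_real, Real.norm_of_nonneg hr.le]
    refine lt_of_le_of_lt (mul_le_mul_of_nonneg_left ?_ hr.le) hηε
    refine (twoNorm_add_le _ _).trans ((add_le_add_right (twoNorm_add_le _ _) _).trans ?_)
    linarith [hPT T' hT'V hT'1, (twoNorm_le (P - groupAlgebraRep G b)).trans hb.le]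

/-! ### Operators matched along a partial isomorphism -/

/-- The pairs of operators `(∑ c_i u_{g_i}, ∑ c_i u_{h_i})`, for finite sums with all `(g_i, h_i)`
in `R`. -/
noncomputable def matchedOps {G H : Type*} [Group G] [Group H] (R : Subgroup (G × H)) :
    Submodule ℂ ((EllTwo G →L[ℂ] EllTwo G) × (EllTwo H →L[ℂ] EllTwo H)) :=
  Submodule.span ℂ ((fun x => (leftRegular G x.1, leftRegular H x.2)) '' (R : Set (G × H)))

/-- A subgroup of `G × H` that is the graph of an isomorphism between a subgroup of `G` and a
subgroup of `H`. -/
def IsPartialIso {G H : Type*} [Group G] [Group H] (R : Subgroup (G × H)) : Prop :=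
  ∀ x ∈ R, x.1 = 1 ↔ x.2 = 1

section
variable {G H : Type*} [Group G] [Group H] {R R' : Subgroup (G × H)}
  {p q : (EllTwo G →L[ℂ] EllTwo G) × (EllTwo H →L[ℂ] EllTwo H)}

theorem matchedOps_mono (h : R ≤ R') : matchedOps R ≤ matchedOps R' :=
  Submodule.span_mono (Set.image_mono h)

theorem leftRegular_mem_matchedOps {x : G × H} (hx : x ∈ R) :
    (leftRegular G x.1, leftRegular H x.2) ∈ matchedOps R :=
  Submodule.subset_span ⟨x, hx, rfl⟩

theorem one_mem_matchedOps : 1 ∈ matchedOps R := by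
  have h := leftRegular_mem_matchedOps (one_mem R)
  simp only [Prod.fst_one, Prod.snd_one, map_one] at h
  exact h

theorem mul_mem_matchedOps (hp : p ∈ matchedOps R) (hq : q ∈ matchedOps R) :
    p * q ∈ matchedOps R := by
  have h := Submodule.mul_mem_mul hp hq
  rw [matchedOps, Submodule.span_mul_span] at h
  refine Submodule.span_mono ?_ h
  rintro _ ⟨_, ⟨x, hx, rfl⟩, _, ⟨y, hy, rfl⟩, rfl⟩
  exact ⟨x * y, mul_mem hx hy, by simp⟩

theorem star_leftRegular (g : G) : star (leftRegular G g) = leftRegular G g⁻¹ := by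
  rw [ContinuousLinearMap.star_eq_adjoint, eq_comm, ContinuousLinearMap.eq_adjoint_iff]
  intro ξ η
  have h1 : η = leftRegular G g⁻¹ (leftRegular G g η) := by
    rw [← mul_apply_eq_comp, ← map_mul]; simp
  nth_rewrite 1 [h1]
  exact (permIsometry (Equiv.mulLeft g⁻¹)).inner_map_map _ _

theorem star_mem_matchedOps (hp : p ∈ matchedOps R) : star p ∈ matchedOps R := by
  induction hp using Submodule.span_induction with
  | mem _ h =>
    obtain ⟨x, hx, rfl⟩ := h
    have : star (leftRegular G x.1, leftRegular H x.2) =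
        (leftRegular G x⁻¹.1, leftRegular H x⁻¹.2) :=
      Prod.ext (star_leftRegular x.1) (star_leftRegular x.2)
    exact this ▸ leftRegular_mem_matchedOps (inv_mem hx)
  | zero => rw [star_zero]; exact zero_mem _
  | add x y _ _ hx hy => rw [star_add]; exact add_mem hx hy
  | smul c x _ hx => rw [star_smul]; exact Submodule.smul_mem _ _ hx

theorem pow_mem_matchedOps (hp : p ∈ matchedOps R) (m : ℕ) : p ^ m ∈ matchedOps R := by
  induction m with
  | zero => rw [pow_zero]; exact one_mem_matchedOps
  | succ m ih => rw [pow_succ]; exact mul_mem_matchedOps ih hp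

theorem vnTrace_leftRegular (g : G) [Decidable (g = 1)] :
    vnTrace (leftRegular G g) = if g = 1 then 1 else 0 := by
  classical
  rw [vnTrace, inner_basisVec]
  change permOp (Equiv.mulLeft g) (basisVec 1) 1 = _
  rw [permOp_basisVec, basisVec_apply]
  simp [eq_comm]

theorem vnTrace_eq_of_mem_matchedOps (hR : IsPartialIso R) (hp : p ∈ matchedOps R) :
    vnTrace p.1 = vnTrace p.2 := by
  classical
  induction hp using Submodule.span_induction with
  | mem _ h =>
    obtain ⟨x, hx, rfl⟩ := h
    simp only [vnTrace_leftRegular, hR x hx]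
  | zero => simp [vnTrace]
  | add x y _ _ hx hy =>
    simp only [vnTrace, Prod.fst_add, Prod.snd_add, add_apply, inner_add_right] at *
    rw [hx, hy]
  | smul c x _ hx =>
    simp only [vnTrace, Prod.smul_fst, Prod.smul_snd, smul_apply, inner_smul_right] at *
    rw [hx]

theorem twoNorm_eq_of_mem_matchedOps (hR : IsPartialIso R) (hp : p ∈ matchedOps R) :
    twoNorm p.1 = twoNorm p.2 := by
  have h := vnTrace_eq_of_mem_matchedOps hR (mul_mem_matchedOps (star_mem_matchedOps hp) hp)
  rw [Prod.fst_mul, Prod.snd_mul, Prod.fst_star, Prod.snd_star] at h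
  rw [twoNorm, twoNorm, h]

theorem leftRegular_mem_groupVN (g : G) : leftRegular G g ∈ groupVN G := by
  have := rep_mem_groupVNSet (MonoidAlgebra.of ℂ G g)
  rwa [groupAlgebraRep, MonoidAlgebra.lift_of] at this

theorem mem_groupVN_of_mem_matchedOps (hp : p ∈ matchedOps R) :
    p.1 ∈ groupVN G ∧ p.2 ∈ groupVN H := by
  induction hp using Submodule.span_induction with
  | mem _ h =>
    obtain ⟨x, hx, rfl⟩ := h
    exact ⟨leftRegular_mem_groupVN x.1, leftRegular_mem_groupVN x.2⟩
  | zero => exact ⟨zero_mem _, zero_mem _⟩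
  | add x y _ _ hx hy => exact ⟨add_mem hx.1 hy.1, add_mem hx.2 hy.2⟩
  | smul c x _ hx => exact ⟨SMulMemClass.smul_mem _ hx.1, SMulMemClass.smul_mem _ hx.2⟩

end

/-! ### The operator norm is determined by the trace -/

theorem norm_apply_pow_two_pow_le {E : Type*} [NormedAddCommGroup E] [InnerProductSpace ℂ E]
    [CompleteSpace E] {A : E →L[ℂ] E} (hA : IsSelfAdjoint A) {ξ : E} (hξ : ‖ξ‖ ≤ 1) (k : ℕ) :
    ‖A ξ‖ ^ 2 ^ k ≤ ‖(A ^ 2 ^ k) ξ‖ := by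
  induction k with
  | zero => simp
  | succ k ih =>
    have h1 : ‖(A ^ 2 ^ k) ξ‖ ^ 2 ≤ ‖(A ^ 2 ^ (k + 1)) ξ‖ := by
      have hs : star (A ^ 2 ^ k) = A ^ 2 ^ k := (hA.pow _).star_eq
      have e : (inner ℂ ((A ^ 2 ^ k) ξ) ((A ^ 2 ^ k) ξ) : ℂ) =
          inner ℂ ((A ^ 2 ^ (k + 1)) ξ) ξ := by
        nth_rewrite 2 [← hs]
        rw [ContinuousLinearMap.star_eq_adjoint, ContinuousLinearMap.adjoint_inner_right,
          ← mul_apply_eq_comp, ← pow_add, pow_succ, mul_two]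
      have h2 := norm_inner_le_norm (𝕜 := ℂ) ((A ^ 2 ^ (k + 1)) ξ) ξ
      rw [← e, inner_self_eq_norm_sq_to_K, norm_pow] at h2
      simp only [Complex.coe_algebraMap, Complex.norm_real, norm_norm] at h2
      exact h2.trans (mul_le_of_le_one_right (norm_nonneg _) hξ)
    calc ‖A ξ‖ ^ 2 ^ (k + 1) = (‖A ξ‖ ^ 2 ^ k) ^ 2 := by rw [← pow_mul, pow_succ]
      _ ≤ ‖(A ^ 2 ^ k) ξ‖ ^ 2 := by gcongr
      _ ≤ _ := h1

theorem le_of_forall_pow_two_pow_le {x c D : ℝ} (hc : 0 ≤ c)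
    (h : ∀ k : ℕ, x ^ 2 ^ k ≤ D * c ^ 2 ^ k) : x ≤ c := by
  by_contra! hlt
  have hx : 0 < x := hc.trans_lt hlt
  have ht : Filter.Tendsto (fun k : ℕ => D * (c / x) ^ 2 ^ k) Filter.atTop (nhds (D * 0)) :=
    ((tendsto_pow_atTop_nhds_zero_of_lt_one (by positivity) ((div_lt_one hx).2 hlt)).comp
      (tendsto_pow_atTop_atTop_of_one_lt one_lt_two)).const_mul D
  rw [mul_zero] at ht
  obtain ⟨k, hk⟩ := (ht.eventually_lt_const one_pos).exists
  rw [div_pow, mul_div_assoc', div_lt_one (by positivity)] at hk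
  exact absurd (h k) (not_le.2 hk)

/-- The moments of `T* T` bound `‖T‖`. For `A = T* T` and `ξ` finitely supported with `‖ξ‖ ≤ 1`,
right invariance of `L(G)` gives `‖A^m ξ‖ ≤ D c^(2m)` with `D` independent of `m`, and
`‖A ξ‖^(2^k) ≤ ‖A^(2^k) ξ‖` removes the constant as `k → ∞`. -/
theorem norm_le_of_twoNorm_pow_le {G : Type*} [Group G] {T : EllTwo G →L[ℂ] EllTwo G}
    (hT : T ∈ groupVN G) {c : ℝ} (hc : 0 ≤ c)
    (h : ∀ m : ℕ, twoNorm ((star T * T) ^ m) ≤ (c ^ 2) ^ m) : ‖T‖ ≤ c := by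
  set A := star T * T with hA
  have hAsa : IsSelfAdjoint A := IsSelfAdjoint.star_mul_self T
  have hAV : A ∈ groupVN G := mul_mem (star_mem hT) hT
  have hspan : ∀ ξ ∈ Submodule.span ℂ (Set.range (basisVec : G → EllTwo G)),
      ∃ D : ℝ, ∀ m, ‖(A ^ m) ξ‖ ≤ D * (c ^ 2) ^ m := by
    intro ξ hξ
    induction hξ using Submodule.span_induction with
    | mem ξ h' =>
      obtain ⟨g, rfl⟩ := h'
      refine ⟨1, fun m => ?_⟩
      rw [groupVN_apply_basisVec (pow_mem hAV m), norm_permOp, ← twoNorm_eq, one_mul]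
      exact h m
    | zero => exact ⟨0, fun m => by simp⟩
    | add x y _ _ hx hy =>
      obtain ⟨D, hD⟩ := hx
      obtain ⟨D', hD'⟩ := hy
      refine ⟨D + D', fun m => ?_⟩
      rw [map_add, add_mul]
      exact (norm_add_le _ _).trans (add_le_add (hD m) (hD' m))
    | smul z x _ hx =>
      obtain ⟨D, hD⟩ := hx
      refine ⟨‖z‖ * D, fun m => ?_⟩
      rw [map_smul, norm_smul, mul_assoc]
      exact mul_le_mul_of_nonneg_left (hD m) (norm_nonneg _)
  have hspan' : ∀ ξ ∈ Submodule.span ℂ (Set.range (basisVec : G → EllTwo G)),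
      ‖A ξ‖ ≤ c ^ 2 * ‖ξ‖ := by
    intro ξ hξ
    rcases eq_or_ne ξ 0 with rfl | h0
    · simp
    have hn : 0 < ‖ξ‖ := norm_pos_iff.2 h0
    obtain ⟨D, hD⟩ := hspan _ (Submodule.smul_mem _ ((‖ξ‖⁻¹ : ℝ) : ℂ) hξ)
    have h1 : ‖((‖ξ‖⁻¹ : ℝ) : ℂ) • ξ‖ ≤ 1 := by
      rw [norm_smul, Complex.norm_real, Real.norm_of_nonneg (by positivity),
        inv_mul_cancel₀ hn.ne']
    have h2 := le_of_forall_pow_two_pow_le (sq_nonneg c) fun k =>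
      (norm_apply_pow_two_pow_le hAsa h1 k).trans (hD _)
    rw [map_smul, norm_smul, Complex.norm_real, Real.norm_of_nonneg (by positivity),
      inv_mul_le_iff₀ hn] at h2
    linarith
  have hd : Dense (Submodule.span ℂ (Set.range (basisVec : G → EllTwo G)) : Set (EllTwo G)) :=
    Submodule.dense_iff_topologicalClosure_eq_top.2 span_basisVec
  have hall : ∀ ξ, ‖A ξ‖ ≤ c ^ 2 * ‖ξ‖ := fun ξ =>
    hd.induction (P := fun ξ => ‖A ξ‖ ≤ c ^ 2 * ‖ξ‖) hspan'
      (isClosed_le (by fun_prop) (by fun_prop)) ξ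
  have h1 : ‖T‖ * ‖T‖ ≤ c ^ 2 :=
    (CStarRing.norm_star_mul_self (x := T)).symm.trans_le (A.opNorm_le_bound (sq_nonneg c) hall)
  exact (sq_le_sq₀ (norm_nonneg _) hc).1 (by rwa [sq ‖T‖])

theorem twoNorm_star_mul_self_pow_le {G : Type*} [Group G] (S : EllTwo G →L[ℂ] EllTwo G) (m : ℕ) :
    twoNorm ((star S * S) ^ m) ≤ (‖S‖ ^ 2) ^ m := by
  rw [sq, ← CStarRing.norm_star_mul_self]
  rcases m.eq_zero_or_pos with rfl | hm
  · rw [pow_zero, pow_zero, twoNorm_eq, one_apply_eq_self, norm_basisVec]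
  · exact (twoNorm_le _).trans (norm_pow_le' _ hm)

theorem norm_eq_of_mem_matchedOps {G H : Type*} [Group G] [Group H] {R : Subgroup (G × H)}
    (hR : IsPartialIso R) {p : (EllTwo G →L[ℂ] EllTwo G) × (EllTwo H →L[ℂ] EllTwo H)}
    (hp : p ∈ matchedOps R) : ‖p.1‖ = ‖p.2‖ := by
  have h (m : ℕ) := twoNorm_eq_of_mem_matchedOps hR
    (pow_mem_matchedOps (mul_mem_matchedOps (star_mem_matchedOps hp) hp) m)
  have hV := mem_groupVN_of_mem_matchedOps hp
  exact le_antisymm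
    (norm_le_of_twoNorm_pow_le hV.1 (norm_nonneg _) fun m =>
      (h m).trans_le (twoNorm_star_mul_self_pow_le _ m))
    (norm_le_of_twoNorm_pow_le hV.2 (norm_nonneg _) fun m =>
      (h m).symm.trans_le (twoNorm_star_mul_self_pow_le _ m))

/-! ### Classical back-and-forth and partial isomorphisms -/

theorem BackForth.mono {L : FirstOrder.Language} {M N : Type*} [L.Structure M] [L.Structure N]
    {α γ : Ordinal} (h : α ≤ γ) {n : ℕ} {a : Fin n → M} {b : Fin n → N}
    (H : BackForth L M N γ n a b) : BackForth L M N α n a b := by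
  rw [BackForth] at H ⊢
  refine ⟨fun h0 => ?_, fun β hβ => H.2 β (hβ.trans_le h)⟩
  rcases eq_or_ne γ 0 with hγ | hγ
  · exact H.1 hγ
  · -- playing the empty tuple at rank `0` gives agreement of quantifier-free types
    obtain ⟨d, hd⟩ := (H.2 0 (pos_iff_ne_zero.2 hγ)).1 0 Fin.elim0
    rw [BackForth] at hd
    have := hd.1 rfl
    rw [Fin.append_right_nil _ _ rfl, Fin.append_right_nil _ _ rfl] at this
    exact this

/-- The subgroup of `G × H` generated by the pairs `(g_i, h_i)`. -/
def graphClosure {G H : Type*} [Group G] [Group H] {k : ℕ} (g : Fin k → G) (h : Fin k → H) :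
    Subgroup (G × H) :=
  Subgroup.closure (Set.range fun i => (g i, h i))

section
variable {G H : Type*} [Group G] [Group H] {k m : ℕ}

theorem graphClosure_le_append (g : Fin k → G) (h : Fin k → H) (g' : Fin m → G) (h' : Fin m → H) :
    graphClosure g h ≤ graphClosure (Fin.append g g') (Fin.append h h') := by
  refine Subgroup.closure_mono ?_
  rintro _ ⟨i, rfl⟩
  exact ⟨Fin.castAdd m i, by simp⟩

theorem append_mem_graphClosure (g : Fin k → G) (h : Fin k → H) (g' : Fin m → G)
    (h' : Fin m → H) (j : Fin m) :
    (g' j, h' j) ∈ graphClosure (Fin.append g g') (Fin.append h h') :=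
  Subgroup.subset_closure ⟨Fin.natAdd k j, by simp⟩

/-- Agreement of quantifier-free types says exactly that `g_i ↦ h_i` extends to an isomorphism of
the generated subgroups. -/
theorem isPartialIso_graphClosure {α : Ordinal} {g : Fin k → G} {h : Fin k → H}
    (hb : BackForth groupLanguage G H α k g h) : IsPartialIso (graphClosure g h) := by
  have hq := hb.mono zero_le
  rw [BackForth] at hq
  have hq := hq.1 rfl
  have key : ∀ x ∈ graphClosure g h, ∃ t : groupLanguage.Term (Fin k),
      t.realize g = x.1 ∧ t.realize h = x.2 := by
    intro x hx
    induction hx using Subgroup.closure_induction with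
    | mem x hx =>
      obtain ⟨i, rfl⟩ := hx
      exact ⟨.var i, rfl, rfl⟩
    | one => exact ⟨.func (show groupLanguage.Functions 0 from GroupFunc.one) Fin.elim0, rfl, rfl⟩
    | mul x y _ _ hx hy =>
      obtain ⟨s, hs, hs'⟩ := hx
      obtain ⟨t, ht, ht'⟩ := hy
      refine ⟨.func (show groupLanguage.Functions 2 from GroupFunc.mul) ![s, t], ?_, ?_⟩
      · exact congrArg₂ (· * ·) hs ht
      · exact congrArg₂ (· * ·) hs' ht'
    | inv x _ hx =>
      obtain ⟨s, hs, hs'⟩ := hx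
      exact ⟨.func (show groupLanguage.Functions 1 from GroupFunc.inv) ![s],
        congrArg (·⁻¹) hs, congrArg (·⁻¹) hs'⟩
  intro x hx
  obtain ⟨t, ht, ht'⟩ := key x hx
  have := hq (t.equal (.func (show groupLanguage.Functions 0 from GroupFunc.one) Fin.elim0))
    (FirstOrder.Language.BoundedFormula.IsAtomic.equal _ _).isQF
  rw [FirstOrder.Language.Formula.realize_equal, FirstOrder.Language.Formula.realize_equal,
    ht, ht'] at this
  exact this

/-! ### Matching partners and approximating tuples -/

theorem groupAlgebraRep_mem_span (b : MonoidAlgebra ℂ G) :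
    ∃ F : Finset G, groupAlgebraRep G b ∈ Submodule.span ℂ (leftRegular G '' F) := by
  classical
  induction b using MonoidAlgebra.induction_on with
  | of g =>
    refine ⟨{g}, Submodule.subset_span ⟨g, by simp, ?_⟩⟩
    simp [groupAlgebraRep]
  | add a b ha hb =>
    obtain ⟨F, hF⟩ := ha
    obtain ⟨F', hF'⟩ := hb
    refine ⟨F ∪ F', ?_⟩
    rw [map_add]
    refine add_mem (Submodule.span_mono (Set.image_mono ?_) hF)
      (Submodule.span_mono (Set.image_mono ?_) hF') <;> simp
  | smul c a ha =>
    obtain ⟨F, hF⟩ := ha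
    exact ⟨F, by rw [map_smul]; exact Submodule.smul_mem _ _ hF⟩

theorem exists_matched_right {R : Subgroup (G × H)} {F : Set G} (hF : ∀ g ∈ F, ∃ h, (g, h) ∈ R)
    {S : EllTwo G →L[ℂ] EllTwo G} (hS : S ∈ Submodule.span ℂ (leftRegular G '' F)) :
    ∃ T, (S, T) ∈ matchedOps R := by
  have h : Submodule.span ℂ (leftRegular G '' F) ≤
      (matchedOps R).map (LinearMap.fst ℂ _ _) := by
    rw [Submodule.span_le]
    rintro _ ⟨g, hg, rfl⟩
    obtain ⟨h, hh⟩ := hF g hg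
    exact ⟨_, leftRegular_mem_matchedOps hh, rfl⟩
  obtain ⟨⟨_, T⟩, hT, rfl⟩ := h hS
  exact ⟨T, hT⟩

theorem exists_matched_left {R : Subgroup (G × H)} {F : Set H} (hF : ∀ h ∈ F, ∃ g, (g, h) ∈ R)
    {T : EllTwo H →L[ℂ] EllTwo H} (hT : T ∈ Submodule.span ℂ (leftRegular H '' F)) :
    ∃ S, (S, T) ∈ matchedOps R := by
  have h : Submodule.span ℂ (leftRegular H '' F) ≤
      (matchedOps R).map (LinearMap.snd ℂ _ _) := by
    rw [Submodule.span_le]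
    rintro _ ⟨h, hh, rfl⟩
    obtain ⟨g, hg⟩ := hF h hh
    exact ⟨_, leftRegular_mem_matchedOps hg, rfl⟩
  obtain ⟨⟨S, _⟩, hS, rfl⟩ := h hT
  exact ⟨S, hS⟩

/-- Finitely many elements of balls of `L(G)` are approximated, inside the same balls, by linear
combinations of finitely many group elements. -/
theorem exists_tuple_approx {t : Fin m → ℕ+} (c : ∀ j, VNBall G (t j)) {δ : ℝ} (hδ : 0 < δ) :
    ∃ (l : ℕ) (g : Fin l → G) (S : ∀ j, VNBall G (t j)), ∀ j, dist (c j) (S j) < δ ∧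
      (S j).op ∈ Submodule.span ℂ (leftRegular G '' Set.range g) := by
  classical
  have h1 (j) : ∃ b, ‖groupAlgebraRep G b‖ ≤ (t j : ℝ) ∧
      twoNorm ((c j).op - groupAlgebraRep G b) < δ :=
    exists_groupAlgebra_twoNorm_sub_lt (c j).mem (by exact_mod_cast (t j).pos) (c j).norm_le hδ
  choose b hb hbd using h1
  choose F hF using fun j => groupAlgebraRep_mem_span (b j)
  let E := Finset.univ.biUnion F
  refine ⟨E.card, fun i => (E.equivFin.symm i : G),
    fun j => ⟨groupAlgebraRep G (b j), rep_mem_groupVNSet _, hb j⟩, fun j => ⟨hbd j, ?_⟩⟩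
  refine Submodule.span_mono (Set.image_mono fun x hx => ?_) (hF j)
  have hxE : x ∈ E := Finset.mem_biUnion.2 ⟨j, Finset.mem_univ _, hx⟩
  exact ⟨E.equivFin ⟨x, hxE⟩, by simp⟩

end

/-! ### Moduli of basic formulas -/

section
open MetricLanguage
variable {L : MetricLanguage} {n : ℕ} {s : Fin n → L.Sorts} (M : MetricStructure L)

theorem MetricLanguage.Term.nndist_eval_le (a b : ∀ i, M.Carrier (s i)) {t : L.Sorts}
    (τ : Term L s t) :
    nndist (τ.eval M a) (τ.eval M b) ≤ τ.modulus fun i => nndist (a i) (b i) := by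
  induction τ with
  | var i => exact le_rfl
  | app f τ ih => exact (M.fn_obeys f _ _).trans ((L.funcMod_isModulus f).mono ih)

theorem MetricLanguage.Atomic.nndist_eval_le (a b : ∀ i, M.Carrier (s i)) (φ : Atomic L s) :
    nndist (φ.eval M a) (φ.eval M b) ≤ φ.modulus fun i => nndist (a i) (b i) := by
  cases φ with
  | pred P τ =>
    exact (M.pr_obeys P _ _).trans
      ((L.predMod_isModulus P).mono fun j => (τ j).nndist_eval_le M a b)
  | dist τ₁ τ₂ =>
    refine le_trans ?_ (add_le_add (τ₁.nndist_eval_le M a b) (τ₂.nndist_eval_le M a b))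
    rw [← NNReal.coe_le_coe]
    exact dist_dist_dist_le _ _ _ _

theorem MetricLanguage.Atomic.eval_mem_bound (a : ∀ i, M.Carrier (s i)) (φ : Atomic L s) :
    φ.eval M a ∈ φ.bound := by
  cases φ with
  | pred P τ => exact M.pr_mem P _
  | dist τ₁ τ₂ => exact ⟨dist_nonneg, M.dist_le_diam _ _ _⟩

theorem MetricLanguage.BasicFormula.edist_eval_le (a b : ∀ i, M.Carrier (s i))
    (φ : BasicFormula L s) :
    edist (φ.eval M a) (φ.eval M b) ≤ φ.modulus fun i => nndist (a i) (b i) := by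
  unfold BasicFormula.modulus leastModulus
  refine le_iSup₂_of_le (fun i => (φ.atom i).eval M a)
    (fun i _ => (φ.atom i).eval_mem_bound M a) ?_
  refine le_iSup₂_of_le (fun i => (φ.atom i).eval M b)
    (fun i _ => (φ.atom i).eval_mem_bound M b) ?_
  refine le_iSup_of_le (fun i => ?_) le_rfl
  exact (φ.atom i).nndist_eval_le M a b

end

/-! ### Truncations of weak moduli -/

namespace WeakModulus

variable (Ω : WeakModulus) {n m : ℕ}

theorem trunc_mono : Monotone (Ω.trunc n) := by
  intro u v h
  refine Ω.mono fun i => ?_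
  dsimp only
  split_ifs with hi
  · exact h _
  · exact le_rfl

theorem trunc_eq_zero {u : Fin n → ℝ≥0} (h : ∀ i, u i = 0) : Ω.trunc n u = 0 := by
  rw [← Ω.zero, trunc]
  congr 1
  ext i
  simp [h]

theorem toFun_sum_le {ι : Type*} (s : Finset ι) (f : ι → ℕ → ℝ≥0) :
    Ω.toFun (∑ i ∈ s, f i) ≤ ∑ i ∈ s, Ω.toFun (f i) :=
  Finset.le_sum_of_subadditive _ Ω.zero.le Ω.subadd _ _

/-- Appending small distances to a tuple of distances changes the value of a weak modulus by
little. -/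
theorem exists_trunc_append_le (n m : ℕ) {ε : ℝ≥0} (hε : 0 < ε) :
    ∃ δ : ℝ≥0, 0 < δ ∧ ∀ u : Fin n → ℝ≥0,
      Ω.trunc (n + m) (Fin.append u fun _ : Fin m => δ) ≤ Ω.trunc n u + ε := by
  have hc : Continuous fun t : ℝ≥0 =>
      ∑ j : Fin m, Ω.toFun (Function.update 0 (n + j) t) :=
    continuous_finsetSum _ fun j _ => Ω.cont_arg _ _
  have h0 : ∑ j : Fin m, Ω.toFun (Function.update 0 (n + j) 0) = 0 :=
    Finset.sum_eq_zero fun j _ => by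
      rw [← Ω.zero]; congr 1; exact Function.update_eq_self_iff.2 rfl
  have h1 : ∀ᶠ t : ℝ≥0 in nhdsWithin 0 (Set.Ioi 0),
      ∑ j : Fin m, Ω.toFun (Function.update 0 (n + j) t) < ε := by
    refine Filter.Eventually.filter_mono nhdsWithin_le_nhds
      ((hc.tendsto 0).eventually_lt_const ?_)
    rw [h0]
    exact_mod_cast hε
  obtain ⟨δ, hδ, hpos⟩ := (h1.and self_mem_nhdsWithin).exists
  refine ⟨δ, hpos, fun u => ?_⟩
  have e : (fun i => if h : i < n + m then (Fin.append u fun _ : Fin m => δ) ⟨i, h⟩ else 0) =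
      (fun i => if h : i < n then u ⟨i, h⟩ else 0) +
        ∑ j : Fin m, (Function.update 0 (n + j) δ : ℕ → ℝ≥0) := by
    ext i
    rw [Pi.add_apply, Finset.sum_apply]
    rcases lt_or_ge i n with hi | hi
    · have h2 : ∀ j : Fin m, (Function.update 0 (n + j) δ : ℕ → ℝ≥0) i = 0 := fun j => by
        rw [Function.update_of_ne (by omega)]; rfl
      have h3 : (⟨i, by omega⟩ : Fin (n + m)) = Fin.castAdd m ⟨i, hi⟩ := rfl
      rw [dif_pos (by omega), h3, Fin.append_left, dif_pos hi, Finset.sum_eq_zero fun j _ => h2 j,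
        add_zero]
    · obtain ⟨l, rfl⟩ := Nat.exists_eq_add_of_le hi
      rw [dif_neg (c := n + l < n) (by omega), zero_add]
      by_cases hl : l < m
      · have h3 : (⟨n + l, by omega⟩ : Fin (n + m)) = Fin.natAdd n ⟨l, hl⟩ := rfl
        rw [dif_pos (by omega), h3, Fin.append_right, Finset.sum_eq_single ⟨l, hl⟩]
        · simp
        · intro j _ hj
          rw [Function.update_of_ne]
          · rfl
          · intro h
            exact hj (Fin.ext (by simp; omega))
        · simp
      · rw [dif_neg (by omega), Finset.sum_eq_zero]
        intro j _
        rw [Function.update_of_ne (by omega)]; rfl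
  rw [trunc, e]
  refine (Ω.subadd _ _).trans (add_le_add_right ?_ _)
  exact (Ω.toFun_sum_le _ _).trans hδ.le

theorem trunc_append_zero (u : Fin n → ℝ≥0) :
    Ω.trunc (n + m) (Fin.append u fun _ : Fin m => 0) = Ω.trunc n u := by
  unfold trunc
  congr 1
  ext i
  by_cases hi : i < n
  · have h3 : (⟨i, by omega⟩ : Fin (n + m)) = Fin.castAdd m ⟨i, hi⟩ := rfl
    rw [dif_pos hi, dif_pos (by omega), h3, Fin.append_left]
  · rw [dif_neg hi]
    by_cases hl : i < n + m
    · have h3 : (⟨i, hl⟩ : Fin (n + m)) = Fin.natAdd n ⟨i - n, by omega⟩ :=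
        Fin.ext (by simp; omega)
      rw [dif_pos hl, h3, Fin.append_right]
    · rw [dif_neg hl]

end WeakModulus

/-! ### The back-and-forth pseudo-distances between group von Neumann algebras -/

section
variable {G H : Type*} [Group G] [Group H] {R R' : Subgroup (G × H)}

variable {n : ℕ} {s : Fin n → vnLanguage.Sorts} {a : ∀ i, (groupVNStructure G).Carrier (s i)}
  {b : ∀ i, (groupVNStructure H).Carrier (s i)}

theorem term_eval_mem_matchedOps
    (hab : ∀ i, (VNBall.op (a i), VNBall.op (b i)) ∈ matchedOps R) {t : vnLanguage.Sorts}
    (τ : MetricLanguage.Term vnLanguage s t) :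
    (VNBall.op (τ.eval (groupVNStructure G) a), VNBall.op (τ.eval (groupVNStructure H) b)) ∈
      matchedOps R := by
  induction τ with
  | var i => exact hab i
  | app f τ ih =>
    cases f with
    | zero => exact zero_mem (matchedOps R)
    | one => exact one_mem_matchedOps
    | incl m n h => exact ih 0
    | add m n => exact add_mem (ih 0) (ih 1)
    | mul m n => exact mul_mem_matchedOps (ih 0) (ih 1)
    | smul c n => exact Submodule.smul_mem _ c (ih 0)
    | star n =>
      have h := star_mem_matchedOps (ih 0)
      rw [Prod.star_def] at h
      exact h

theorem atomic_eval_eq (hR : IsPartialIso R)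
    (hab : ∀ i, (VNBall.op (a i), VNBall.op (b i)) ∈ matchedOps R)
    (φ : MetricLanguage.Atomic vnLanguage s) :
    φ.eval (groupVNStructure G) a = φ.eval (groupVNStructure H) b := by
  cases φ with
  | pred P τ =>
    cases P with
    | reTr n =>
      exact congrArg Complex.re
        (vnTrace_eq_of_mem_matchedOps hR (term_eval_mem_matchedOps hab (τ 0)))
    | imTr n =>
      exact congrArg Complex.im
        (vnTrace_eq_of_mem_matchedOps hR (term_eval_mem_matchedOps hab (τ 0)))
  | dist τ₁ τ₂ =>
    have h := twoNorm_eq_of_mem_matchedOps hR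
      (sub_mem (term_eval_mem_matchedOps hab τ₁) (term_eval_mem_matchedOps hab τ₂))
    rw [Prod.fst_sub, Prod.snd_sub] at h
    exact h

/-- The pair `q` of elements of the same ball of `L(G)` and of `L(H)` is within distances `r`
and `r'` of a pair of elements of that ball which is matched along `R`. -/
def IsNearMatched (R : Subgroup (G × H)) (q : Σ s : ℕ+, VNBall G s × VNBall H s)
    (r r' : ℝ≥0) : Prop :=
  ∃ (S : VNBall G q.1) (T : VNBall H q.1), (S.op, T.op) ∈ matchedOps R ∧
    nndist q.2.1 S ≤ r ∧ nndist q.2.2 T ≤ r'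

theorem IsNearMatched.mono (h : R ≤ R') {q : Σ s : ℕ+, VNBall G s × VNBall H s}
    {r r' : ℝ≥0} (hq : IsNearMatched R q r r') : IsNearMatched R' q r r' := by
  obtain ⟨S, T, hST, h1, h2⟩ := hq
  exact ⟨S, T, matchedOps_mono h hST, h1, h2⟩

theorem bfDistZero_le (Ω : WeakModulus) (hR : IsPartialIso R) {n : ℕ}
    (p : TuplePair (groupVNStructure G) (groupVNStructure H) n) (u v : Fin n → ℝ≥0)
    (hp : ∀ i, IsNearMatched R (p i) (u i) (v i)) :
    bfDistZero Ω (groupVNStructure G) (groupVNStructure H) p ≤ Ω.trunc n u + Ω.trunc n v := by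
  choose S T hST hS hT using hp
  refine iSup₂_le fun φ hφ => ?_
  have h1 : φ.eval (groupVNStructure G) S = φ.eval (groupVNStructure H) T :=
    congrArg φ.conn (funext fun i => atomic_eval_eq hR hST (φ.atom i))
  refine (edist_triangle _ (φ.eval (groupVNStructure G) S) _).trans (add_le_add ?_ ?_)
  · exact ((φ.edist_eval_le (groupVNStructure G) _ S).trans (hφ _)).trans (Ω.trunc_mono hS)
  · rw [h1, edist_comm]
    exact ((φ.edist_eval_le (groupVNStructure H) _ T).trans (hφ _)).trans (Ω.trunc_mono hT)

/-- The pseudo-distance of two tuples is controlled by their distances `u`, `v` to tuples matched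
along related tuples of group elements. Allowing such an error makes the induction go through: each
move of the game can only be matched approximately. -/
theorem bfDist_le (Ω : WeakModulus) (α : Ordinal) : ∀ {n k : ℕ} {g : Fin k → G} {h : Fin k → H}
    (_ : BackForth groupLanguage G H α k g h)
    (p : TuplePair (groupVNStructure G) (groupVNStructure H) n) (u v : Fin n → ℝ≥0)
    (_ : ∀ i, IsNearMatched (graphClosure g h) (p i) (u i) (v i)),
    bfDist Ω (groupVNStructure G) (groupVNStructure H) α n p ≤ Ω.trunc n u + Ω.trunc n v := by
  induction α using WellFoundedLT.induction with
  | ind α ih =>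
  intro n k g h hb p u v hp
  rw [bfDist]
  split_ifs with h0
  · exact bfDistZero_le Ω (isPartialIso_graphClosure hb) p u v hp
  rw [BackForth] at hb
  refine sup_le (iSup_le fun β => iSup_le fun m => iSup_le fun t => iSup_le fun c => ?_)
    (iSup_le fun β => iSup_le fun m => iSup_le fun t => iSup_le fun d => ?_)
  · refine ENNReal.le_of_forall_pos_le_add fun ε hε _ => ?_
    obtain ⟨δ, hδ, hΩ⟩ := Ω.exists_trunc_append_le n m hε
    obtain ⟨l, g', S, hS⟩ := exists_tuple_approx c (NNReal.coe_pos.2 hδ)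
    obtain ⟨h', hb'⟩ := (hb.2 β.1 β.2).1 l g'
    have hR := isPartialIso_graphClosure hb'
    choose T hT using fun j => exists_matched_right
      (by rintro _ ⟨i, rfl⟩; exact ⟨h' i, append_mem_graphClosure g h g' h' i⟩) (hS j).2
    let d : ∀ j, VNBall H (t j) := fun j =>
      ⟨T j, (mem_groupVN_of_mem_matchedOps (hT j)).2,
        (norm_eq_of_mem_matchedOps hR (hT j)).symm.trans_le (S j).norm_le⟩
    refine iInf_le_of_le d ((ih β.1 β.2 hb' _ (Fin.append u fun _ => δ)
      (Fin.append v fun _ => 0) fun i => ?_).trans ?_)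
    · refine Fin.addCases (fun i => ?_) (fun j => ?_) i
      · simp only [TuplePair.concat, Fin.append_left]
        exact (hp i).mono (graphClosure_le_append g h g' h')
      · simp only [TuplePair.concat, Fin.append_right]
        exact ⟨S j, d j, hT j, NNReal.coe_le_coe.1 (hS j).1.le, (nndist_self _).le⟩
    · rw [Ω.trunc_append_zero, add_right_comm]
      exact add_le_add_left (hΩ u) _
  · refine ENNReal.le_of_forall_pos_le_add fun ε hε _ => ?_
    obtain ⟨δ, hδ, hΩ⟩ := Ω.exists_trunc_append_le n m hε
    obtain ⟨l, h', T, hT⟩ := exists_tuple_approx d (NNReal.coe_pos.2 hδ)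
    obtain ⟨g', hb'⟩ := (hb.2 β.1 β.2).2 l h'
    have hR := isPartialIso_graphClosure hb'
    choose S hS using fun j => exists_matched_left
      (by rintro _ ⟨i, rfl⟩; exact ⟨g' i, append_mem_graphClosure g h g' h' i⟩) (hT j).2
    let c : ∀ j, VNBall G (t j) := fun j =>
      ⟨S j, (mem_groupVN_of_mem_matchedOps (hS j)).1,
        (norm_eq_of_mem_matchedOps hR (hS j)).trans_le (T j).norm_le⟩
    refine iInf_le_of_le c ((ih β.1 β.2 hb' _ (Fin.append u fun _ => 0)
      (Fin.append v fun _ => δ) fun i => ?_).trans ?_)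
    · refine Fin.addCases (fun i => ?_) (fun j => ?_) i
      · simp only [TuplePair.concat, Fin.append_left]
        exact (hp i).mono (graphClosure_le_append g h g' h')
      · simp only [TuplePair.concat, Fin.append_right]
        exact ⟨c j, T j, hS j, (nndist_self _).le, NNReal.coe_le_coe.1 (hT j).1.le⟩
    · rw [Ω.trunc_append_zero, add_assoc]
      exact add_le_add_right (hΩ v) _

end

theorem mainTheorem1 (α : Ordinal) (G H : Type*) [Group G] [Group H]
    (h : GroupBackForth G H (1 + α)) (Ω : WeakModulus) :
    MetricBackForth Ω α (groupVNStructure G) (groupVNStructure H) := by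
  refine le_antisymm ((bfDist_le Ω α (h.mono le_add_self) _ Fin.elim0 Fin.elim0
    fun i => i.elim0).trans ?_) zero_le
  rw [Ω.trunc_eq_zero fun i => i.elim0, add_zero]
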